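/- \textbf{Lemma (Approximating the absolute value of ngap).} For a Boolean function $f:\{0,1\}^n\to\{0,1\}$ let $\mathrm{gap}(f)=|f^{-1}(1)|-|f^{-1}(0)|$ and $\mathrm{ngap}(f)=\mathrm{gap}(f)/2^n$. A function $f:\{0,1\}^*\to\mathbb N$ is in $\#\mathsf P$ if there are a polynomial-time algorithm $C$ with output in $\{0,1\}$ and a polynomial $p$ such that $f(x)=|\{y\in\{0,1\}^{p(|x|)}: C(x,y)=1\}|$ for all $x$; $\mathsf{GapP}$ is the class of functions $g:\{0,1\}^*\to\mathbb Z$ of the form $g=a-b$ with $a,b\in\#\mathsf P$. Consider the following computational problem. The input describes a Boolean function $f$ that arises from a $\#\mathsf P$ function: it consists of an algorithm $C$, a string $x\in\{0,1\}^*$ and numbers $n,t$ written in unary, and $f:\{0,1\}^n\to\{0,1\}$ has $f(y)=1$ if and only if $C$ on input $(x,y)$ halts within $t$ steps with output $1$. The task is to output a rational number $s$ (a fraction of binary integers) that approximates $\mathrm{ngap}(f)^2$. This problem is $\mathsf{GapP}$-hard in each of the following two settings: (a) for any fixed relative error $0<\epsilon<1/2$, that is, $(1-\epsilon)\,\mathrm{ngap}(f)^2\le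 s\le(1+\epsilon)\,\mathrm{ngap}(f)^2$; (b) for additive error $2^{-2n}$, that is, $|s-\mathrm{ngap}(f)^2|\le 2^{-2n}$. Here $\mathsf{GapP}$-hard means that every $g\in\mathsf{GapP}$ is polynomial-time Turing (Cook) reducible to the problem: there is an oracle algorithm $M$ (depending on $g$ and, in (a), on $\epsilon$) that computes $g$ with every oracle that solves the problem and whose answers have length polynomially bounded in the length of the question, and for each polynomial bound on the answer lengths the running time of $M$ is bounded by a polynomial in $|x|$ that is the same for all such oracles. -/

import Mathlib

namespace NGap

/-! ### Algorithms: multi-stack machines with structured control, an oracle, and a step count -/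

/-- Programs over registers `0, 1, 2, …`, each holding a bit string that is accessed as a stack. -/
inductive Prog : Type
  | skip : Prog
  /-- put the bit `b` on top of register `r` -/
  | push (r : ℕ) (b : Bool) : Prog
  /-- remove the top bit of register `r` (nothing happens if `r` is empty) -/
  | pop (r : ℕ) : Prog
  /-- ask the oracle the string in register `q` and store its answer in register `a` -/
  | query (q a : ℕ) : Prog
  | seq (c d : Prog) : Prog
  /-- branch on register `r`: empty, top bit `false`, top bit `true` -/
  | cases (r : ℕ) (cNil cFalse cTrue : Prog) : Prog
  /-- repeat `c` as long as register `r` is nonempty -/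
  | loop (r : ℕ) (c : Prog) : Prog

/-- The contents of the registers. -/
abbrev State : Type := ℕ → List Bool

/-- `Exec O c s t s'`: with oracle `O`, program `c` started in state `s` halts after exactly `t`
steps in state `s'`. Every elementary operation touches one bit and costs one step; an oracle call
is charged one step and, in addition, the lengths of the question and of the answer. -/
inductive Exec (O : List Bool → List Bool) : Prog → State → ℕ → State → Prop
  | skip (s : State) : Exec O .skip s 1 s
  | push (r : ℕ) (b : Bool) (s : State) :
      Exec O (.push r b) s 1 (Function.update s r (b :: s r))
  | pop (r : ℕ) (s : State) :
      Exec O (.pop r) s 1 (Function.update s r (s r).tail)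
  | query (q a : ℕ) (s : State) :
      Exec O (.query q a) s (1 + (s q).length + (O (s q)).length) (Function.update s a (O (s q)))
  | seq {c d : Prog} {s s' s'' : State} {t t' : ℕ} :
      Exec O c s t s' → Exec O d s' t' s'' → Exec O (.seq c d) s (t + t') s''
  | casesNil {r : ℕ} {c₀ c₁ c₂ : Prog} {s s' : State} {t : ℕ} :
      s r = [] → Exec O c₀ s t s' → Exec O (.cases r c₀ c₁ c₂) s (t + 1) s'
  | casesFalse {r : ℕ} {c₀ c₁ c₂ : Prog} {s s' : State} {t : ℕ} {l : List Bool} :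
      s r = false :: l → Exec O c₁ s t s' → Exec O (.cases r c₀ c₁ c₂) s (t + 1) s'
  | casesTrue {r : ℕ} {c₀ c₁ c₂ : Prog} {s s' : State} {t : ℕ} {l : List Bool} :
      s r = true :: l → Exec O c₂ s t s' → Exec O (.cases r c₀ c₁ c₂) s (t + 1) s'
  | loopDone {r : ℕ} {c : Prog} {s : State} :
      s r = [] → Exec O (.loop r c) s 1 s
  | loopStep {r : ℕ} {c : Prog} {s s' s'' : State} {t t' : ℕ} :
      s r ≠ [] → Exec O c s t s' → Exec O (.loop r c) s' t' s'' →
      Exec O (.loop r c) s (t + t' + 1) s''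

/-- Programs are deterministic: final state and step count are determined. -/
theorem Exec.det {O : List Bool → List Bool} {c : Prog} {s s₁ s₂ : State} {t₁ t₂ : ℕ}
    (h₁ : Exec O c s t₁ s₁) (h₂ : Exec O c s t₂ s₂) : t₁ = t₂ ∧ s₁ = s₂ := by
  induction h₁ generalizing t₂ s₂ with
  | skip | push | pop | query => cases h₂; exact ⟨rfl, rfl⟩
  | seq _ _ ih ih' =>
    cases h₂ with
    | seq a b =>
      obtain ⟨rfl, rfl⟩ := ih a
      obtain ⟨rfl, rfl⟩ := ih' b
      exact ⟨rfl, rfl⟩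
  | casesNil h _ ih | casesFalse h _ ih | casesTrue h _ ih =>
    cases h₂ with
    | casesNil h' a | casesFalse h' a | casesTrue h' a =>
      first
      | (obtain ⟨rfl, rfl⟩ := ih a; exact ⟨rfl, rfl⟩)
      | simp [h] at h'
  | loopDone h =>
    cases h₂ with
    | loopDone => exact ⟨rfl, rfl⟩
    | loopStep h' => exact absurd h h'
  | loopStep h _ _ ih ih' =>
    cases h₂ with
    | loopDone h' => exact absurd h' h
    | loopStep _ a b =>
      obtain ⟨rfl, rfl⟩ := ih a
      obtain ⟨rfl, rfl⟩ := ih' b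
      exact ⟨rfl, rfl⟩

/-- The trivial oracle, which answers every question with the empty string: programs run with it
are ordinary algorithms without an oracle. -/
def noOracle : List Bool → List Bool := fun _ => []

/-- The initial state on one input string. -/
def input (x : List Bool) : State := fun r => if r = 0 then x else []

/-- The initial state on two input strings. -/
def input₂ (x y : List Bool) : State := fun r => if r = 0 then x else if r = 1 then y else []

/-! ### Encodings by bit strings -/

/-- Self-delimiting pairing of bit strings. -/
def pair : List Bool → List Bool → List Bool
  | [], v => false :: v
  | b :: u, v => true :: b :: pair u v

/-- The number `n` in unary. -/
def unary (n : ℕ) : List Bool := List.replicate n true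

/-- Integers in binary: a sign bit, then the absolute value, least significant bit first. -/
def encodeInt (z : ℤ) : List Bool := decide (z < 0) :: z.natAbs.bits

/-- The fraction `a / d` (not necessarily reduced), numerator and denominator in binary. -/
def encodeFrac (a : ℤ) (d : ℕ) : List Bool := pair (encodeInt a) d.bits

/-- Programs as bit strings: a three-bit tag, then the arguments. -/
def encodeProg : Prog → List Bool
  | .skip => [false, false, false]
  | .push r b => [false, false, true] ++ pair (unary r) [b]
  | .pop r => [false, true, false] ++ pair (unary r) []
  | .query q a => [false, true, true] ++ pair (unary q) (pair (unary a) [])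
  | .seq c d => [true, false, false] ++ (encodeProg c ++ encodeProg d)
  | .cases r c₀ c₁ c₂ =>
      [true, false, true] ++ pair (unary r) (encodeProg c₀ ++ (encodeProg c₁ ++ encodeProg c₂))
  | .loop r c => [true, true, false] ++ pair (unary r) (encodeProg c)

/-- The string encoding a program `C`, a string `x`, and the numbers `n` and `t` in unary. -/
def encodeInstance (C : Prog) (x : List Bool) (n t : ℕ) : List Bool :=
  pair (encodeProg C) (pair x (pair (unary n) (unary t)))

theorem pair_inj {u v u' v' : List Bool} (h : pair u v = pair u' v') : u = u' ∧ v = v' := by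
  induction u generalizing u' with
  | nil => cases u' <;> simp_all [pair]
  | cons b u ih =>
    cases u' with
    | nil => simp [pair] at h
    | cons b' u' =>
      simp only [pair, List.cons.injEq, true_and] at h
      obtain ⟨h₁, h₂⟩ := ih h.2
      exact ⟨by rw [h.1, h₁], h₂⟩

theorem pair_append (u v w : List Bool) : pair u v ++ w = pair u (v ++ w) := by
  induction u with
  | nil => rfl
  | cons b u ih => simp [pair, ih]

theorem unary_inj {m n : ℕ} (h : unary m = unary n) : m = n := by
  simpa [unary] using congrArg List.length h

theorem encodeProg_append_inj {c d : Prog} {u v : List Bool}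
    (h : encodeProg c ++ u = encodeProg d ++ v) : c = d ∧ u = v := by
  induction c generalizing d u v with
  | skip | push | pop | query =>
    cases d <;> simp [encodeProg, pair_append] at h ⊢ <;>
      grind [pair_inj, unary_inj]
  | seq c₁ c₂ ih₁ ih₂ =>
    cases d with
    | seq d₁ d₂ =>
      simp only [encodeProg, List.append_assoc, List.append_cancel_left_eq] at h
      obtain ⟨rfl, k₁⟩ := ih₁ h
      obtain ⟨rfl, k₂⟩ := ih₂ k₁
      exact ⟨rfl, k₂⟩
    | _ => simp [encodeProg] at h
  | cases r c₀ c₁ c₂ ih₀ ih₁ ih₂ =>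
    cases d with
    | cases r' d₀ d₁ d₂ =>
      simp only [encodeProg, List.append_assoc, List.append_cancel_left_eq, pair_append] at h
      obtain ⟨hr, k⟩ := pair_inj h
      obtain rfl := unary_inj hr
      obtain ⟨rfl, k₀⟩ := ih₀ k
      obtain ⟨rfl, k₁⟩ := ih₁ k₀
      obtain ⟨rfl, k₂⟩ := ih₂ k₁
      exact ⟨rfl, k₂⟩
    | _ => simp [encodeProg] at h
  | loop r c ih =>
    cases d with
    | loop r' d =>
      simp only [encodeProg, List.append_assoc, List.append_cancel_left_eq, pair_append] at h
      obtain ⟨hr, k⟩ := pair_inj h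
      obtain rfl := unary_inj hr
      obtain ⟨rfl, k₁⟩ := ih k
      exact ⟨rfl, k₁⟩
    | _ => simp [encodeProg] at h

/-- An instance string determines the data that it encodes. -/
theorem encodeInstance_inj {C C' : Prog} {x x' : List Bool} {n n' t t' : ℕ}
    (h : encodeInstance C x n t = encodeInstance C' x' n' t') :
    C = C' ∧ x = x' ∧ n = n' ∧ t = t' := by
  obtain ⟨h₁, h⟩ := pair_inj h
  obtain ⟨h₂, h⟩ := pair_inj h
  obtain ⟨h₃, h₄⟩ := pair_inj h
  exact ⟨(encodeProg_append_inj (congrArg (· ++ []) h₁)).1, h₂, unary_inj h₃, unary_inj h₄⟩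

/-! ### The function classes #P and GapP -/

/-- The predicate `V` on pairs of strings is decided by a polynomial-time algorithm, which leaves
the answer, a single bit, in register `0`. -/
def PolyTimePred (V : List Bool → List Bool → Bool) : Prop :=
  ∃ (C : Prog) (T : Polynomial ℕ), ∀ x y : List Bool, ∃ (t : ℕ) (s : State),
    t ≤ T.eval (x.length + y.length) ∧ Exec noOracle C (input₂ x y) t s ∧ s 0 = [V x y]

/-- `f` belongs to #P. -/
def SharpP (f : List Bool → ℕ) : Prop :=
  ∃ (V : List Bool → List Bool → Bool) (p : Polynomial ℕ), PolyTimePred V ∧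
    ∀ x : List Bool,
      f x = Fintype.card {y : Fin (p.eval x.length) → Bool // V x (List.ofFn y) = true}

/-- `g` belongs to GapP: it is the difference of two functions in #P. -/
def GapP (g : List Bool → ℤ) : Prop :=
  ∃ a b : List Bool → ℕ, SharpP a ∧ SharpP b ∧ ∀ x, g x = (a x : ℤ) - (b x : ℤ)

/-! ### Gaps -/

/-- The gap of a Boolean function on `n` bits. -/
def gap {n : ℕ} (f : (Fin n → Bool) → Bool) : ℤ :=
  (Fintype.card {y // f y = true} : ℤ) - (Fintype.card {y // f y = false} : ℤ)

/-- The normalized gap of a Boolean function on `n` bits. -/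
noncomputable def ngap {n : ℕ} (f : (Fin n → Bool) → Bool) : ℝ := (gap f : ℝ) / 2 ^ n

open Classical in
/-- The Boolean function on `n` bits given by an algorithm `C`, a string `x` and a time bound `t`:
its value at `y` is `1` iff `C` on input `(x, y)` halts within `t` steps with output `1`. -/
noncomputable def boolFn (C : Prog) (x : List Bool) (n t : ℕ) : (Fin n → Bool) → Bool :=
  fun y => decide (∃ (t' : ℕ) (s : State),
    t' ≤ t ∧ Exec noOracle C (input₂ x (List.ofFn y)) t' s ∧ s 0 = [true])

/-! ### Approximation and hardness -/

/-- `s` is an `r`-relative approximation of `S`. -/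
def RelApprox (r S s : ℝ) : Prop := (1 - r) * S ≤ s ∧ s ≤ (1 + r) * S

/-- `s` is an `e`-additive approximation of `S`. -/
def AddApprox (e S s : ℝ) : Prop := |S - s| ≤ e

/-- The search problem: given a Boolean function `f` on `n` bits, as `(C, x, 1ⁿ, 1ᵗ)`, output a
fraction `a / d` that approximates `ngap(f)²` in the sense of `approx n`. Strings that are not
instances may be answered arbitrarily. -/
def ApproxNgapSq (approx : ℕ → ℝ → ℝ → Prop) (inst ans : List Bool) : Prop :=
  ∀ (C : Prog) (x : List Bool) (n t : ℕ), inst = encodeInstance C x n t →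
    ∃ (a : ℤ) (d : ℕ), 0 < d ∧ ans = encodeFrac a d ∧
      approx n (ngap (boolFn C x n t) ^ 2) ((a : ℝ) / (d : ℝ))

/-- The function `g` is polynomial-time Turing (Cook) reducible to the search problem `R`: a single
oracle program computes `g` with every oracle that solves `R`, in time polynomial in the input
length, where the polynomial depends only on a polynomial bound `q` for the oracle's answers. -/
def CookReducible (g : List Bool → ℤ) (R : List Bool → List Bool → Prop) : Prop :=
  ∃ M : Prog, ∀ q : Polynomial ℕ, ∃ T : Polynomial ℕ, ∀ O : List Bool → List Bool,
    (∀ z, R z (O z)) → (∀ z, (O z).length ≤ q.eval z.length) →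
      ∀ x : List Bool, ∃ (t : ℕ) (s : State),
        t ≤ T.eval x.length ∧ Exec O M (input x) t s ∧ s 0 = encodeInt (g x)

/-- `R` is GapP-hard: every function in GapP is Cook reducible to `R`. -/
def GapPHard (R : List Bool → List Bool → Prop) : Prop :=
  ∀ g : List Bool → ℤ, GapP g → CookReducible g R

end NGap

/-! Let `g = a - b` with `a, b` in #P, and put `A = g x`. For every integer `D = A - v * 2 ^ m`,
where `v` is given by positive and negative binary digits, there is an instance with gap exactly `2
* D`. Its first input bit is a sign that negates the output, and its second bit selects either the
padded witnesses of `a` and `b` or predicates satisfied by a prescribed number of strings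
(`count_padded`, `count_lookup`, `gap_instFn`). One fixed program evaluates all these functions,
with `x` and the digits as its string argument.

An oracle only reveals `D ^ 2` approximately, but two answers for the same `n` tell which of two
integers has the larger absolute value up to a factor `√3` (`Discriminates`). For relative error
this is `(1 + ε) / (1 - ε) < 3`. For additive error the square of the normalized gap is `4 * D ^ 2 /
2 ^ (2 * n)`, so two errors of `1 / 2 ^ (2 * n)` are less than the spacing of the possible values.

Such comparisons suffice to find `A` in signed digits, most significant first, keeping the residue
`B = A - v * 2 ^ m` below `2 ^ m` in absolute value. Passing to the next digit position gives `|B| <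
2 * h` with `h = 2 ^ m`, and the candidates `B`, `B - h`, `B + h` are compared in a small
tournament. The digits `-1, 0, 1` are redundant, so a wrong comparison between nearly equal
candidates is harmless: the winner is always below `h` (`Compares.abs_digitStep_lt`). At `m = 0` the
residue is zero.

The rest is complexity bookkeeping: a calculus of polynomial-time functions relative to a class of
oracles (`PolyTime`), closed under pairing, branching, folds and queries. It serves both for the
program inside the instances (trivial oracle) and for the reduction (oracles with bounded answers).
Time bounds never use that the oracle is correct. -/

namespace NGap

/-! ### Running programs within a time bound -/

/-- With oracle `O`, program `c` started in `s` halts in `s'` after at most `B` steps. -/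
def Runs (O : List Bool → List Bool) (c : Prog) (s : State) (B : ℕ) (s' : State) : Prop :=
  ∃ t ≤ B, Exec O c s t s'

section Runs

variable {O : List Bool → List Bool}

theorem Runs.mono {c : Prog} {s s' : State} {B B' : ℕ} (h : Runs O c s B s') (hB : B ≤ B') :
    Runs O c s B' s' := by
  obtain ⟨t, ht, e⟩ := h
  exact ⟨t, ht.trans hB, e⟩

theorem Runs.seq {c d : Prog} {s s' s'' : State} {B B' : ℕ} (h : Runs O c s B s')
    (h' : Runs O d s' B' s'') : Runs O (.seq c d) s (B + B') s'' := by
  obtain ⟨t, ht, e⟩ := h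
  obtain ⟨t', ht', e'⟩ := h'
  exact ⟨t + t', add_le_add ht ht', .seq e e'⟩

theorem runs_skip (s : State) : Runs O .skip s 1 s := ⟨1, le_rfl, .skip s⟩

theorem runs_push (r : ℕ) (b : Bool) (s : State) :
    Runs O (.push r b) s 1 (Function.update s r (b :: s r)) := ⟨1, le_rfl, .push r b s⟩

theorem runs_pop (r : ℕ) (s : State) :
    Runs O (.pop r) s 1 (Function.update s r (s r).tail) := ⟨1, le_rfl, .pop r s⟩

theorem Runs.casesNil {r : ℕ} {c₀ c₁ c₂ : Prog} {s s' : State} {B : ℕ} (hr : s r = [])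
    (h : Runs O c₀ s B s') : Runs O (.cases r c₀ c₁ c₂) s (B + 1) s' := by
  obtain ⟨t, ht, e⟩ := h
  exact ⟨t + 1, by omega, .casesNil hr e⟩

theorem Runs.casesCons {r : ℕ} {c₀ : Prog} {f : Bool → Prog} {s s' : State} {B : ℕ} {b : Bool}
    {l : List Bool} (hr : s r = b :: l) (h : Runs O (f b) s B s') :
    Runs O (.cases r c₀ (f false) (f true)) s (B + 1) s' := by
  obtain ⟨t, ht, e⟩ := h
  cases b
  · exact ⟨t + 1, by omega, .casesFalse hr e⟩
  · exact ⟨t + 1, by omega, .casesTrue hr e⟩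

theorem Runs.casesFalse {r : ℕ} {c₀ c₁ c₂ : Prog} {s s' : State} {B : ℕ} {l : List Bool}
    (hr : s r = false :: l) (h : Runs O c₁ s B s') : Runs O (.cases r c₀ c₁ c₂) s (B + 1) s' := by
  obtain ⟨t, ht, e⟩ := h
  exact ⟨t + 1, by omega, .casesFalse hr e⟩

theorem Runs.casesTrue {r : ℕ} {c₀ c₁ c₂ : Prog} {s s' : State} {B : ℕ} {l : List Bool}
    (hr : s r = true :: l) (h : Runs O c₂ s B s') : Runs O (.cases r c₀ c₁ c₂) s (B + 1) s' := by
  obtain ⟨t, ht, e⟩ := h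
  exact ⟨t + 1, by omega, .casesTrue hr e⟩

theorem runs_loop_nil {r : ℕ} {c : Prog} {s : State} (hr : s r = []) :
    Runs O (.loop r c) s 1 s := ⟨1, le_rfl, .loopDone hr⟩

theorem Runs.loopStep {r : ℕ} {c : Prog} {s s' s'' : State} {B B' : ℕ} (hr : s r ≠ [])
    (h : Runs O c s B s') (h' : Runs O (.loop r c) s' B' s'') :
    Runs O (.loop r c) s (B + B' + 1) s'' := by
  obtain ⟨t, ht, e⟩ := h
  obtain ⟨t', ht', e'⟩ := h'
  exact ⟨t + t' + 1, by omega, .loopStep hr e e'⟩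

/-- A push adds one bit, and a query is charged for the length of its answer. Hence time bounds are
also bounds on the size of results. -/
theorem Exec.length_le {c : Prog} {s s' : State} {t : ℕ} (h : Exec O c s t s') (r : ℕ) :
    (s' r).length ≤ (s r).length + t := by
  induction h with
  | skip => omega
  | push r' b s =>
    rcases eq_or_ne r r' with rfl | h <;> simp [*]
  | pop r' s =>
    rcases eq_or_ne r r' with rfl | h <;> simp [*]; omega
  | query q a s =>
    rcases eq_or_ne r a with rfl | h <;> simp [*]; omega
  | seq _ _ ih ih' | loopStep _ _ _ ih ih' => omega
  | casesNil _ _ ih | casesFalse _ _ ih | casesTrue _ _ ih => omega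
  | loopDone => omega

/-- Empty the register `r`, executing `f b` for every bit `b` taken from it. -/
def drain (r : ℕ) (f : Bool → Prog) : Prog :=
  .loop r (.cases r .skip (.seq (.pop r) (f false)) (.seq (.pop r) (f true)))

/-- The loop rule behind nearly all programs here: `S l a` is the state with `l` left in `r` and
abstract data `a`, and `P` is the invariant. The overhead of 3 per bit pays for the loop test, the
branch and the pop. -/
theorem runs_drain {α : Type*} {r : ℕ} {f : Bool → Prog} {S : List Bool → α → State}
    {g : α → Bool → α} {P : List Bool → α → Prop} {B : ℕ} (hS : ∀ l a, S l a r = l)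
    (hu : ∀ b l a, Function.update (S (b :: l) a) r l = S l a)
    (hstep : ∀ b l a, P (b :: l) a → P l (g a b) ∧ Runs O (f b) (S l a) B (S l (g a b)))
    (l : List Bool) (a : α) (h : P l a) :
    Runs O (drain r f) (S l a) ((B + 3) * l.length + 1) (S [] (l.foldl g a)) := by
  induction l generalizing a with
  | nil => exact (runs_loop_nil (hS _ _)).mono (by omega)
  | cons b l ih =>
    obtain ⟨h₁, h₂⟩ := hstep b l a h
    have hp : Runs O (.pop r) (S (b :: l) a) 1 (S l a) := by
      have := runs_pop (O := O) r (S (b :: l) a)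
      rwa [hS, List.tail_cons, hu] at this
    have hc := Runs.casesCons (c₀ := .skip) (f := fun b => .seq (.pop r) (f b)) (hS (b :: l) a)
      (hp.seq h₂)
    refine (Runs.loopStep (by simp [hS]) hc (ih _ h₁)).mono ?_
    simp only [List.length_cons]
    ring_nf
    omega

/-- Empty the register `r`. -/
def clear (r : ℕ) : Prog := drain r fun _ => .skip

theorem runs_clear (r : ℕ) (s : State) :
    Runs O (clear r) s (4 * (s r).length + 1) (Function.update s r []) := by
  have := runs_drain (O := O) (r := r) (f := fun _ => .skip)
    (S := fun l (_ : Unit) => Function.update s r l) (g := fun a _ => a) (P := fun _ _ => True)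
    (B := 1) (by simp) (by simp) (fun b l a _ => ⟨trivial, runs_skip _⟩) (s r) () trivial
  simpa [clear] using this

/-- Pour the register `r` onto the register `q`, reversing the order of the bits. -/
def pour (r q : ℕ) : Prog := drain r fun b => .push q b

theorem runs_pour {r q : ℕ} (h : r ≠ q) (s : State) :
    Runs O (pour r q) s (4 * (s r).length + 1)
      (Function.update (Function.update s r []) q ((s r).reverse ++ s q)) := by
  have := runs_drain (O := O) (r := r) (f := fun b => .push q b)
    (S := fun l a => Function.update (Function.update s r l) q a) (g := fun a b => b :: a)
    (P := fun _ _ => True) (B := 1) (by simp [h])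
    (by intro b l a; rw [Function.update_comm h.symm, Function.update_idem, Function.update_comm h])
    (fun b l a _ => ⟨trivial, by
      simpa using runs_push (O := O) q b (Function.update (Function.update s r l) q a)⟩)
    (s r) (s q) trivial
  simpa [pour] using this

end Runs

/-! ### Register layouts -/

/-- The state with `x` in register `0`, followed by the registers of `s`. -/
def scons (x : List Bool) (s : State) : State
  | 0 => x
  | r + 1 => s r

theorem update_scons_zero (x y : List Bool) (s : State) :
    Function.update (scons x s) 0 y = scons y s := by
  funext r; cases r <;> simp [scons]

theorem update_scons_succ (x y : List Bool) (s : State) (r : ℕ) :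
    Function.update (scons x s) (r + 1) y = scons x (Function.update s r y) := by
  funext k
  cases k with
  | zero => simp [scons]
  | succ k => by_cases h : k = r <;> simp [scons, h]

/-- The program `c` with all registers renamed from `r` to `r + 1`. -/
def Prog.up : Prog → Prog
  | .skip => .skip
  | .push r b => .push (r + 1) b
  | .pop r => .pop (r + 1)
  | .query q a => .query (q + 1) (a + 1)
  | .seq c d => .seq c.up d.up
  | .cases r c₀ c₁ c₂ => .cases (r + 1) c₀.up c₁.up c₂.up
  | .loop r c => .loop (r + 1) c.up

/-- Shifting the registers frees register `0`, which can then keep a value safe while a subroutine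
runs. -/
theorem Exec.up {O : List Bool → List Bool} {c : Prog} {s s' : State} {t : ℕ}
    (h : Exec O c s t s') (x : List Bool) : Exec O c.up (scons x s) t (scons x s') := by
  induction h with
  | skip s => exact .skip _
  | push r b s => rw [← update_scons_succ]; exact .push (r + 1) b (scons x s)
  | pop r s => rw [← update_scons_succ]; exact .pop (r + 1) (scons x s)
  | query q a s => rw [← update_scons_succ]; exact .query (q + 1) (a + 1) (scons x s)
  | seq _ _ ih ih' => exact .seq ih ih'
  | casesNil h _ ih => exact .casesNil h ih
  | casesFalse h _ ih => exact .casesFalse h ih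
  | casesTrue h _ ih => exact .casesTrue h ih
  | loopDone h => exact .loopDone h
  | loopStep h _ _ ih ih' => exact .loopStep h ih ih'

/-- The state with given contents of registers `0` to `3`, and all others empty. -/
def st (a b c d : List Bool) : State := scons a (scons b (scons c (scons d fun _ => [])))

section st

variable (a b c d x : List Bool)

@[simp] theorem st_zero : st a b c d 0 = a := rfl
@[simp] theorem st_one : st a b c d 1 = b := rfl
@[simp] theorem st_two : st a b c d 2 = c := rfl
@[simp] theorem st_three : st a b c d 3 = d := rfl

@[simp] theorem update_st_zero : Function.update (st a b c d) 0 x = st x b c d :=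
  update_scons_zero ..

@[simp] theorem update_st_one : Function.update (st a b c d) 1 x = st a x c d := by
  rw [st, ← zero_add 1, update_scons_succ, update_scons_zero, st]

@[simp] theorem update_st_two : Function.update (st a b c d) 2 x = st a b x d := by
  rw [st, show 2 = 0 + 1 + 1 from rfl, update_scons_succ, update_scons_succ, update_scons_zero, st]

@[simp] theorem update_st_three : Function.update (st a b c d) 3 x = st a b c x := by
  rw [st, show 3 = 0 + 1 + 1 + 1 from rfl, update_scons_succ, update_scons_succ,
    update_scons_succ, update_scons_zero, st]

theorem input_eq_st : input x = st x [] [] [] := by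
  funext r
  match r with
  | 0 | 1 | 2 | 3 | r + 4 => rfl

theorem input₂_eq_st : input₂ a b = st a b [] [] := by
  funext r
  match r with
  | 0 | 1 | 2 | 3 | r + 4 => rfl

theorem scons_input : scons a (input b) = st a b [] [] := by
  funext r
  match r with
  | 0 | 1 | 2 | 3 | r + 4 => rfl

end st

/-! ### Pairing programs -/

section Programs

variable {O : List Bool → List Bool}

theorem Runs.up {c : Prog} {y z : List Bool} {B : ℕ} (h : Runs O c (input y) B (input z))
    (x : List Bool) : Runs O c.up (st x y [] []) B (st x z [] []) := by
  obtain ⟨t, ht, e⟩ := h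
  exact ⟨t, ht, by simpa only [scons_input] using e.up x⟩

/-- Copy register `0` to register `1`. -/
def copyProg : Prog := .seq (pour 0 2) (drain 2 fun b => .seq (.push 0 b) (.push 1 b))

theorem runs_copy (x : List Bool) :
    Runs O copyProg (st x [] [] []) (9 * x.length + 2) (st x x [] []) := by
  have h₁ : Runs O (pour 0 2) (st x [] [] []) (4 * x.length + 1) (st [] [] x.reverse []) := by
    simpa using runs_pour (O := O) (show 0 ≠ 2 by decide) (st x [] [] [])
  have h₂ := runs_drain (O := O) (r := 2) (f := fun b => .seq (.push 0 b) (.push 1 b))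
    (S := fun l a => st a a l []) (g := fun a b => b :: a) (P := fun _ _ => True) (B := 2)
    (by simp) (by simp)
    (fun b l a _ => ⟨trivial, by
      simpa using (runs_push (O := O) 0 b (st a a l [])).seq (runs_push 1 b _)⟩)
    x.reverse [] trivial
  simp only [List.foldl_reverse, List.foldr_cons_nil, List.length_reverse] at h₂
  exact (h₁.seq h₂).mono (by omega)

/-- Exchange registers `0` and `1`. -/
def swapProg : Prog :=
  .seq (.seq (pour 0 2) (pour 1 3)) (.seq (pour 2 1) (pour 3 0))

theorem runs_swap (x y : List Bool) :
    Runs O swapProg (st x y [] []) (8 * x.length + 8 * y.length + 4) (st y x [] []) := by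
  have h₁ := runs_pour (O := O) (show 0 ≠ 2 by decide) (st x y [] [])
  have h₂ := runs_pour (O := O) (show 1 ≠ 3 by decide) (st [] y x.reverse [])
  have h₃ := runs_pour (O := O) (show 2 ≠ 1 by decide) (st [] [] x.reverse y.reverse)
  have h₄ := runs_pour (O := O) (show 3 ≠ 0 by decide) (st [] x [] y.reverse)
  simp at h₁ h₂ h₃ h₄
  exact ((h₁.seq h₂).seq (h₃.seq h₄)).mono (by omega)

/-- Move register `1` to register `0`. -/
def moveProg : Prog := .seq (pour 1 2) (pour 2 0)

theorem runs_move (y : List Bool) :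
    Runs O moveProg (st [] y [] []) (8 * y.length + 2) (st y [] [] []) := by
  have h₁ := runs_pour (O := O) (show 1 ≠ 2 by decide) (st [] y [] [])
  have h₂ := runs_pour (O := O) (show 2 ≠ 0 by decide) (st [] [] y.reverse [])
  simp at h₁ h₂
  exact (h₁.seq h₂).mono (by omega)

theorem length_pair (u v : List Bool) : (pair u v).length = 2 * u.length + v.length + 1 := by
  induction u with
  | nil => simp [pair]
  | cons b u ih => simp [pair, ih]; ring

theorem pair_eq_foldr (u v : List Bool) :
    pair u v = u.foldr (fun b l => true :: b :: l) (false :: v) := by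
  induction u with
  | nil => rfl
  | cons b u ih => simp [pair, ih]

/-- Pair the strings in registers `0` and `1`. -/
def pairProg : Prog :=
  .seq (.seq (pour 0 2) (.push 1 false))
    (.seq (drain 2 fun b => .seq (.push 1 b) (.push 1 true)) moveProg)

theorem runs_pair (u v : List Bool) :
    Runs O pairProg (st u v [] []) (25 * u.length + 8 * v.length + 13)
      (st (pair u v) [] [] []) := by
  have h₁ := runs_pour (O := O) (show 0 ≠ 2 by decide) (st u v [] [])
  have h₂ := runs_push (O := O) 1 false (st [] v u.reverse [])
  have h₃ := runs_drain (O := O) (r := 2) (f := fun b => .seq (.push 1 b) (.push 1 true))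
    (S := fun l a => st [] a l []) (g := fun a b => true :: b :: a) (P := fun _ _ => True) (B := 2)
    (by simp) (by simp)
    (fun b l a _ => ⟨trivial, by
      simpa using (runs_push (O := O) 1 b (st [] a l [])).seq (runs_push 1 true _)⟩)
    u.reverse (false :: v) trivial
  have h₄ := runs_move (O := O) (pair u v)
  simp only [List.foldl_reverse, ← pair_eq_foldr, List.length_reverse] at h₃
  simp [length_pair] at h₁ h₂ h₄
  exact ((h₁.seq h₂).seq (h₃.seq h₄)).mono (by omega)

/-- The inverse of `pair`, extended to all strings. -/
def unpair : List Bool → List Bool × List Bool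
  | true :: b :: l => (b :: (unpair l).1, (unpair l).2)
  | false :: l => ([], l)
  | [] => ([], [])
  | [true] => ([], [])

@[simp] theorem unpair_pair (u v : List Bool) : unpair (pair u v) = (u, v) := by
  induction u with
  | nil => rfl
  | cons b u ih => simp [pair, unpair, ih]

theorem length_unpair (l : List Bool) :
    (unpair l).1.length + (unpair l).2.length ≤ l.length := by
  fun_induction unpair l with
  | case1 b l ih => simp; omega
  | case2 | case3 | case4 => simp

/-- The main loop of `unpairProg`, controlled by the flag in register `2`. -/
def unpairLoop : Prog :=
  .loop 2 (.cases 0 (.pop 2) (.seq (.pop 0) (.pop 2)) (.seq (.pop 0)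
    (.cases 0 .skip (.seq (.pop 0) (.push 1 false)) (.seq (.pop 0) (.push 1 true)))))

theorem runs_unpairLoop (l acc : List Bool) :
    Runs O unpairLoop (st l acc [true] []) (7 * l.length + 6)
      (st (unpair l).2 ((unpair l).1.reverse ++ acc) [] []) := by
  have hnil : ∀ acc, Runs O unpairLoop (st [] acc [true] []) 4 (st [] acc [] []) := by
    intro acc
    have h := runs_pop (O := O) 2 (st [] acc [true] [])
    simp at h
    exact Runs.loopStep (by simp) (Runs.casesNil (by simp) h) (runs_loop_nil (by simp))
  fun_induction unpair l generalizing acc with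
  | case1 b l ih =>
    have h₁ := runs_pop (O := O) 0 (st (true :: b :: l) acc [true] [])
    have h₂ := runs_pop (O := O) 0 (st (b :: l) acc [true] [])
    have h₃ := runs_push (O := O) 1 b (st l acc [true] [])
    simp at h₁ h₂ h₃
    have h₄ := Runs.casesCons (r := 0) (c₀ := .skip) (l := l)
      (f := fun b => .seq (.pop 0) (.push 1 b)) (by simp) (h₂.seq h₃)
    have h₅ := Runs.loopStep (r := 2) (by simp) (Runs.casesTrue (c₀ := .pop 2)
      (c₁ := .seq (.pop 0) (.pop 2)) (st_zero ..) (h₁.seq h₄)) (ih (b :: acc))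
    simpa [unpairLoop] using h₅.mono (B' := 7 * (l.length + 2) + 6) (by omega)
  | case2 l =>
    have h₁ := runs_pop (O := O) 0 (st (false :: l) acc [true] [])
    have h₂ := runs_pop (O := O) 2 (st l acc [true] [])
    simp at h₁ h₂
    exact (Runs.loopStep (by simp) (Runs.casesFalse (st_zero ..) (h₁.seq h₂))
      (runs_loop_nil (by simp))).mono (by omega)
  | case3 => simpa using (hnil acc).mono (by simp)
  | case4 =>
    have h₁ := runs_pop (O := O) 0 (st [true] acc [true] [])
    simp at h₁
    have h₄ := Runs.casesNil (O := O) (r := 0) (c₁ := .seq (.pop 0) (.push 1 false))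
      (c₂ := .seq (.pop 0) (.push 1 true)) (s := st [] acc [true] []) (by simp) (runs_skip _)
    exact (Runs.loopStep (by simp) (Runs.casesTrue (st_zero ..) (h₁.seq h₄)) (hnil acc)).mono
      (by simp)

/-- Split a pair in register `0` into registers `0` and `1`. -/
def unpairProg : Prog :=
  .seq (.seq (.push 2 true) unpairLoop)
    (.seq (.seq (pour 0 2) (pour 1 0)) (pour 2 1))

theorem runs_unpair (l : List Bool) :
    Runs O unpairProg (st l [] [] []) (20 * l.length + 20)
      (st (unpair l).1 (unpair l).2 [] []) := by
  have hl := length_unpair l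
  have h₀ := runs_push (O := O) 2 true (st l [] [] [])
  have h₁ := runs_unpairLoop (O := O) l []
  generalize unpair l = p at *
  obtain ⟨u, v⟩ := p
  have h₂ := runs_pour (O := O) (show 0 ≠ 2 by decide) (st v u.reverse [] [])
  have h₃ := runs_pour (O := O) (show 1 ≠ 0 by decide) (st [] u.reverse v.reverse [])
  have h₄ := runs_pour (O := O) (show 2 ≠ 1 by decide) (st u [] v.reverse [])
  simp at h₀ h₁ h₂ h₃ h₄ hl
  exact ((h₀.seq h₁).seq ((h₂.seq h₃).seq h₄)).mono (by omega)

end Programs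

open Polynomial

/-! ### Polynomial-time functions relative to an oracle -/

/-- Types whose elements are represented by bit strings. -/
class Enc (α : Type) where
  /-- the representation -/
  enc : α → List Bool

open Enc

instance : Enc (List Bool) := ⟨id⟩
instance : Enc Bool := ⟨fun b => [b]⟩
instance {α β : Type} [Enc α] [Enc β] : Enc (α × β) := ⟨fun p => pair (enc p.1) (enc p.2)⟩

@[simp] theorem enc_list (l : List Bool) : enc l = l := rfl
@[simp] theorem enc_bool (b : Bool) : enc b = [b] := rfl
@[simp] theorem enc_prod {α β : Type} [Enc α] [Enc β] (p : α × β) :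
    enc p = pair (enc p.1) (enc p.2) := rfl

/-- The function `F` is computed by a single oracle program, in polynomial time, where the
polynomial depends only on the index `q` of the class `𝓖 q` that contains the oracle. -/
def PolyTime {α β : Type} [Enc α] [Enc β] (𝓖 : ℕ[X] → Set (List Bool → List Bool))
    (F : (List Bool → List Bool) → α → β) : Prop :=
  ∃ P : Prog, ∀ q, ∃ T : ℕ[X], ∀ O ∈ 𝓖 q, ∀ a,
    Runs O P (input (enc a)) (T.eval (enc a).length) (input (enc (F O a)))

theorem eval_le_eval (p : ℕ[X]) {m n : ℕ} (h : m ≤ n) : p.eval m ≤ p.eval n := by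
  rw [eval_eq_sum, eval_eq_sum]
  exact Finset.sum_le_sum fun i _ => Nat.mul_le_mul_left _ (Nat.pow_le_pow_left h i)

/-! ### Closure properties of polynomial-time functions -/

namespace PolyTime

variable {α β γ σ α' β' : Type} [Enc α] [Enc β] [Enc γ] [Enc σ] [Enc α'] [Enc β']
  {𝓖 : ℕ[X] → Set (List Bool → List Bool)}

theorem length_le {F : (List Bool → List Bool) → α → β} (hF : PolyTime 𝓖 F) (q : ℕ[X]) :
    ∃ T : ℕ[X], ∀ O ∈ 𝓖 q, ∀ a, (enc (F O a)).length ≤ T.eval (enc a).length := by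
  obtain ⟨P, hP⟩ := hF
  obtain ⟨T, hT⟩ := hP q
  refine ⟨X + T, fun O hO a => ?_⟩
  obtain ⟨t, ht, e⟩ := hT O hO a
  have := e.length_le 0
  simp [input] at this ⊢
  omega

theorem recode {F : (List Bool → List Bool) → α → β} (hF : PolyTime 𝓖 F)
    {F' : (List Bool → List Bool) → α' → β'} (e : α' → α) (he : ∀ a, enc (e a) = enc a)
    (hF' : ∀ O a, enc (F' O a) = enc (F O (e a))) : PolyTime 𝓖 F' := by
  obtain ⟨P, hP⟩ := hF
  refine ⟨P, fun q => ?_⟩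
  obtain ⟨T, hT⟩ := hP q
  refine ⟨T, fun O hO a => ?_⟩
  have := hT O hO (e a)
  rwa [he, ← hF'] at this

theorem of_linear {F : (List Bool → List Bool) → α → β} (P : Prog) (k : ℕ)
    (h : ∀ O a, Runs O P (st (enc a) [] [] []) (k * (enc a).length + k)
      (st (enc (F O a)) [] [] [])) : PolyTime 𝓖 F :=
  ⟨P, fun _ => ⟨C k * X + C k, fun O _ a => by simpa [input_eq_st] using h O a⟩⟩

/-- Programs chain because they leave all registers but `0` empty. The length bound for the
intermediate value keeps the composed time polynomial. -/
theorem comp {G : (List Bool → List Bool) → β → γ} {F : (List Bool → List Bool) → α → β}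
    (hG : PolyTime 𝓖 G) (hF : PolyTime 𝓖 F) : PolyTime 𝓖 fun O a => G O (F O a) := by
  obtain ⟨Q, hQ⟩ := hG
  have hl := hF.length_le
  obtain ⟨P, hP⟩ := hF
  refine ⟨.seq P Q, fun q => ?_⟩
  obtain ⟨T, hT⟩ := hP q
  obtain ⟨U, hU⟩ := hQ q
  obtain ⟨L, hL⟩ := hl q
  refine ⟨T + U.comp L, fun O hO a => ?_⟩
  refine ((hT O hO a).seq (hU O hO _)).mono ?_
  simpa using eval_le_eval U (hL O hO a)

protected theorem id : PolyTime 𝓖 fun _ (a : α) => a :=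
  of_linear .skip 1 fun O a => (runs_skip _).mono (by omega)

theorem tail {l : (List Bool → List Bool) → α → List Bool} (hl : PolyTime 𝓖 l) :
    PolyTime 𝓖 fun O a => (l O a).tail :=
  comp (of_linear (F := fun _ (l : List Bool) => l.tail) (.pop 0) 1 fun O a =>
    (by simpa using runs_pop (O := O) 0 (st a [] [] []) : Runs O _ _ 1 _).mono (by omega)) hl

theorem consBit (b : Bool) {l : (List Bool → List Bool) → α → List Bool} (hl : PolyTime 𝓖 l) :
    PolyTime 𝓖 fun O a => b :: l O a :=
  comp (of_linear (F := fun _ (l : List Bool) => b :: l) (.push 0 b) 1 fun O a =>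
    (by simpa using runs_push (O := O) 0 b (st a [] [] []) : Runs O _ _ 1 _).mono (by omega)) hl

theorem nil : PolyTime 𝓖 fun _ (_ : α) => ([] : List Bool) :=
  of_linear (clear 0) 4 fun O a => by
    have := runs_clear (O := O) 0 (st (enc a) [] [] [])
    simp at this
    exact this.mono (by omega)

theorem const (l : List Bool) : PolyTime 𝓖 fun _ (_ : α) => l := by
  induction l with
  | nil => exact nil
  | cons b l ih => exact ih.consBit b

theorem constBool (b : Bool) : PolyTime 𝓖 fun _ (_ : α) => b :=
  (const [b]).recode id (fun _ => rfl) fun _ _ => rfl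

/-- The first bit of a string, or `false` if the string is empty. -/
theorem headD {l : (List Bool → List Bool) → α → List Bool} (hl : PolyTime 𝓖 l) :
    PolyTime 𝓖 fun O a => (l O a).headD false := by
  refine comp (of_linear (F := fun _ l => l.headD false) (.cases 0 (.push 0 false)
    (.seq (clear 0) (.push 0 false)) (.seq (clear 0) (.push 0 true))) 10 fun O a => ?_) hl
  have h := fun b : Bool => runs_push (O := O) 0 b (st [] [] [] [])
  have h' := runs_clear (O := O) 0 (st a [] [] [])
  simp at h h'
  rcases a with _ | ⟨b, a⟩
  · exact (Runs.casesNil rfl h.1).mono (by simp)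
  · cases b
    · exact (Runs.casesFalse rfl (h'.seq h.1)).mono (by simp; omega)
    · exact (Runs.casesTrue rfl (h'.seq h.2)).mono (by simp; omega)

theorem unpairFst {l : (List Bool → List Bool) → α → List Bool} (hl : PolyTime 𝓖 l) :
    PolyTime 𝓖 fun O a => (unpair (l O a)).1 := by
  refine comp (G := fun _ l => (unpair l).1) (of_linear (.seq unpairProg (clear 1)) 40
    fun O a => ?_) hl
  have h := runs_clear (O := O) 1 (st (unpair a).1 (unpair a).2 [] [])
  have := length_unpair a
  simp at h
  exact ((runs_unpair a).seq h).mono (by simp; omega)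

theorem unpairSnd {l : (List Bool → List Bool) → α → List Bool} (hl : PolyTime 𝓖 l) :
    PolyTime 𝓖 fun O a => (unpair (l O a)).2 := by
  refine comp (G := fun _ l => (unpair l).2) (of_linear
    (.seq unpairProg (.seq (clear 0) moveProg)) 40 fun O a => ?_) hl
  have h := runs_clear (O := O) 0 (st (unpair a).1 (unpair a).2 [] [])
  have := length_unpair a
  simp at h
  exact ((runs_unpair a).seq (h.seq (runs_move _))).mono (by simp; omega)

theorem raw {F : (List Bool → List Bool) → α → β} (hF : PolyTime 𝓖 F) :
    PolyTime 𝓖 fun O a => enc (F O a) :=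
  hF.recode id (fun _ => rfl) fun _ _ => rfl

theorem fst {F : (List Bool → List Bool) → α → β × γ} (hF : PolyTime 𝓖 F) :
    PolyTime 𝓖 fun O a => (F O a).1 :=
  hF.raw.unpairFst.recode id (fun _ => rfl) fun _ _ => by simp

theorem snd {F : (List Bool → List Bool) → α → β × γ} (hF : PolyTime 𝓖 F) :
    PolyTime 𝓖 fun O a => (F O a).2 :=
  hF.raw.unpairSnd.recode id (fun _ => rfl) fun _ _ => by simp

/-- The input is copied, and each function runs in shifted registers: the first with the input
stored in register `0`, the second, after a swap, with the first result stored there. -/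
theorem prodMk {F : (List Bool → List Bool) → α → β} {G : (List Bool → List Bool) → α → γ}
    (hF : PolyTime 𝓖 F) (hG : PolyTime 𝓖 G) : PolyTime 𝓖 fun O a => (F O a, G O a) := by
  have hl := hF.length_le
  have hl' := hG.length_le
  obtain ⟨P, hP⟩ := hF
  obtain ⟨Q, hQ⟩ := hG
  refine ⟨.seq (.seq copyProg P.up) (.seq (.seq swapProg Q.up) pairProg), fun q => ?_⟩
  obtain ⟨T, hT⟩ := hP q
  obtain ⟨U, hU⟩ := hQ q
  obtain ⟨L, hL⟩ := hl q
  obtain ⟨K, hK⟩ := hl' q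
  refine ⟨T + U + C 40 * L + C 40 * K + C 40 * X + C 40, fun O hO a => ?_⟩
  have h₁ := (hT O hO a).up (enc a)
  have h₂ := (hU O hO a).up (enc (F O a))
  have := hL O hO a
  have := hK O hO a
  rw [input_eq_st, input_eq_st]
  refine (((runs_copy _).seq h₁).seq (((runs_swap _ _).seq h₂).seq (runs_pair _ _))).mono ?_
  simp
  omega

theorem cond {b : (List Bool → List Bool) → α → Bool} {F G : (List Bool → List Bool) → α → β}
    (hb : PolyTime 𝓖 b) (hF : PolyTime 𝓖 F) (hG : PolyTime 𝓖 G) :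
    PolyTime 𝓖 fun O a => bif b O a then F O a else G O a := by
  suffices h : PolyTime 𝓖 fun O (p : Bool × α) => bif p.1 then F O p.2 else G O p.2 from
    h.comp (hb.prodMk .id)
  have hl := hF.length_le
  have hl' := hG.length_le
  obtain ⟨P, hP⟩ := hF
  obtain ⟨Q, hQ⟩ := hG
  refine ⟨.seq unpairProg (.seq (.cases 0 .skip (.seq (.pop 0) Q.up) (.seq (.pop 0) P.up))
    moveProg), fun q => ?_⟩
  obtain ⟨T, hT⟩ := hP q
  obtain ⟨U, hU⟩ := hQ q
  obtain ⟨L, hL⟩ := hl q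
  obtain ⟨K, hK⟩ := hl' q
  refine ⟨T + U + C 40 * L + C 40 * K + C 40 * X + C 40, fun O hO p => ?_⟩
  obtain ⟨b, a⟩ := p
  have h₁ := (hT O hO a).up []
  have h₂ := (hU O hO a).up []
  have h₃ := hL O hO a
  have h₄ := hK O hO a
  have hpop := runs_pop (O := O) 0 (st [b] (enc a) [] [])
  have hun := runs_unpair (O := O) (enc (b, a))
  simp only [enc_prod, unpair_pair, enc_bool] at hun
  simp at hpop
  have hle : (enc a).length ≤ (enc (b, a)).length := by simp [length_pair]; omega
  have e₁ := eval_le_eval T hle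
  have e₂ := eval_le_eval U hle
  have e₃ := eval_le_eval L hle
  have e₄ := eval_le_eval K hle
  rw [input_eq_st, input_eq_st]
  cases b
  · refine (hun.seq ((Runs.casesFalse rfl (hpop.seq h₂)).seq (runs_move _))).mono ?_
    simp at *
    omega
  · refine (hun.seq ((Runs.casesTrue rfl (hpop.seq h₁)).seq (runs_move _))).mono ?_
    simp at *
    omega

theorem of_forall_bool {f : (List Bool → List Bool) → α → Bool → β}
    (hf : ∀ b, PolyTime 𝓖 fun O a => f O a b) {b : (List Bool → List Bool) → α → Bool}
    (hb : PolyTime 𝓖 b) : PolyTime 𝓖 fun O a => f O a (b O a) := by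
  convert hb.cond (hf true) (hf false) using 3 with O a
  cases b O a <;> rfl

theorem cons {b : (List Bool → List Bool) → α → Bool} {l : (List Bool → List Bool) → α → List Bool}
    (hb : PolyTime 𝓖 b) (hl : PolyTime 𝓖 l) : PolyTime 𝓖 fun O a => b O a :: l O a :=
  of_forall_bool (f := fun O a b => b :: l O a) (fun b => hl.consBit b) hb

/-- Every function of a bit is polynomial-time. -/
theorem bit (f : Bool → Bool) {b : (List Bool → List Bool) → α → Bool} (hb : PolyTime 𝓖 b) :
    PolyTime 𝓖 fun O a => f (b O a) :=
  of_forall_bool (f := fun _ _ b => f b) (fun b => constBool (f b)) hb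

theorem bit₂ (f : Bool → Bool → Bool) {b c : (List Bool → List Bool) → α → Bool}
    (hb : PolyTime 𝓖 b) (hc : PolyTime 𝓖 c) : PolyTime 𝓖 fun O a => f (b O a) (c O a) :=
  of_forall_bool (f := fun O a b => f b (c O a)) (fun b => hc.bit (f b)) hb

theorem foldl_of_length_le {g : (List Bool → List Bool) → σ → Bool → σ}
    (hg : ∀ b, PolyTime 𝓖 fun O s => g O s b)
    (hL : ∀ q, ∃ L : ℕ[X], ∀ O ∈ 𝓖 q, ∀ (l : List Bool) s,
      (enc (l.foldl (g O) s)).length ≤ L.eval (enc (l, s)).length) :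
    PolyTime 𝓖 fun O (p : List Bool × σ) => p.1.foldl (g O) p.2 := by
  choose P hP using hg
  refine ⟨.seq unpairProg (.seq (drain 0 fun b => (P b).up) moveProg), fun q => ?_⟩
  obtain ⟨L, hL⟩ := hL q
  choose T hT using fun b => hP b q
  refine ⟨(T true + T false).comp L * X + C 40 * X + C 40 + C 40 * L, fun O hO p => ?_⟩
  obtain ⟨l, s⟩ := p
  set N := (enc (l, s)).length with hN
  have hl : l.length ≤ N := by simp [hN, length_pair]; omega
  have hun := runs_unpair (O := O) (enc (l, s))
  simp only [enc_prod, unpair_pair, enc_list] at hun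
  have hd := runs_drain (O := O) (r := 0) (f := fun b => (P b).up)
    (S := fun l a => st l (enc a) [] []) (g := g O)
    -- Every intermediate state is itself a fold over a prefix `k` of `l`, so the assumed length
    -- bound applies to it.
    (P := fun m a => ∃ k, k ++ m = l ∧ a = k.foldl (g O) s)
    (B := (T true + T false).eval (L.eval N)) (by simp) (by simp)
    (by
      rintro b m a ⟨k, rfl, rfl⟩
      refine ⟨⟨k ++ [b], by simp, by simp⟩, ((hT b O hO _).up m).mono ?_⟩
      have : (enc (k.foldl (g O) s)).length ≤ L.eval N :=
        (hL O hO k s).trans (eval_le_eval L (by simp [hN, length_pair]))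
      have := eval_le_eval (T b) this
      cases b <;> simp at this ⊢ <;> omega) l s ⟨[], rfl, rfl⟩
  have := hL O hO l s
  have h₁ : (T true + T false).eval (L.eval N) * l.length ≤
    (T true + T false).eval (L.eval N) * N := Nat.mul_le_mul_left _ hl
  rw [input_eq_st, input_eq_st]
  refine (hun.seq (hd.seq (runs_move _))).mono ?_
  simp at *
  simp only [← hN] at *
  nlinarith

/-- The growth per step is additive and depends only on the read-only parameter `c`, not on the
state. After all steps the state is therefore still of polynomial length, which excludes repeated
squaring. -/
theorem foldl {f : (List Bool → List Bool) → γ → σ → Bool → σ}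
    {c : (List Bool → List Bool) → α → γ} {i : (List Bool → List Bool) → α → σ}
    {l : (List Bool → List Bool) → α → List Bool}
    (hf : ∀ b, PolyTime 𝓖 fun O (p : γ × σ) => f O p.1 p.2 b)
    (hB : ∀ q, ∃ B : ℕ[X], ∀ O ∈ 𝓖 q, ∀ c s b,
      (enc (f O c s b)).length ≤ (enc s).length + B.eval (enc c).length)
    (hc : PolyTime 𝓖 c) (hi : PolyTime 𝓖 i) (hl : PolyTime 𝓖 l) :
    PolyTime 𝓖 fun O a => (l O a).foldl (f O (c O a)) (i O a) := by
  have key : ∀ O (l : List Bool) (p : γ × σ),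
      l.foldl (fun (p : γ × σ) b => (p.1, f O p.1 p.2 b)) p = (p.1, l.foldl (f O p.1) p.2) := by
    intro O l
    induction l with
    | nil => simp
    | cons b l ih => intro p; simp [ih]
  have h := foldl_of_length_le (𝓖 := 𝓖)
    (g := fun O (p : γ × σ) b => (p.1, f O p.1 p.2 b))
    (fun b => prodMk (fst .id) (hf b)) (by
      intro q
      obtain ⟨B, hB⟩ := hB q
      refine ⟨C 2 * X + X * B + X + C 1, fun O hO l p => ?_⟩
      obtain ⟨c, s⟩ := p
      have : (enc (l.foldl (f O c) s)).length ≤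
          (enc s).length + l.length * B.eval (enc c).length := by
        induction l generalizing s with
        | nil => simp
        | cons b l ih =>
          have h₁ := ih (f O c s b)
          have h₂ := hB O hO c s b
          simp only [List.foldl_cons, List.length_cons, add_mul]
          omega
      rw [key]
      simp only [enc_prod, length_pair, enc_list, eval_add, eval_mul, eval_C, eval_X]
      have hm : l.length * B.eval (enc c).length ≤
          (2 * l.length + (2 * (enc c).length + (enc s).length + 1) + 1) *
          B.eval (2 * l.length + (2 * (enc c).length + (enc s).length + 1) + 1) :=
        Nat.mul_le_mul (by omega) (eval_le_eval B (by omega))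
      omega)
  have := (h.comp (hl.prodMk (hc.prodMk hi))).snd
  simpa only [key] using this

theorem query (h𝓖 : ∀ q, ∃ p : ℕ[X], ∀ O ∈ 𝓖 q, ∀ z, (O z).length ≤ p.eval z.length)
    {l : (List Bool → List Bool) → α → List Bool} (hl : PolyTime 𝓖 l) :
    PolyTime 𝓖 fun O a => O (l O a) := by
  refine comp (G := fun O z => O z) ⟨.query 0 0, fun q => ?_⟩ hl
  obtain ⟨p, hp⟩ := h𝓖 q
  refine ⟨C 1 + X + p, fun O hO z => ?_⟩
  have h := Exec.query (O := O) 0 0 (st z [] [] [])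
  have := hp O hO z
  simp at h
  exact ⟨1 + z.length + (O z).length, by simpa using this, by simpa [input_eq_st] using h⟩

end PolyTime

/-! ### Decision algorithms on two inputs -/

/-- A strict upper bound for the registers in a program. -/
def Prog.bound : Prog → ℕ
  | .skip => 0
  | .push r _ => r + 1
  | .pop r => r + 1
  | .query _ a => a + 1
  | .seq c d => max c.bound d.bound
  | .cases _ c₀ c₁ c₂ => max c₀.bound (max c₁.bound c₂.bound)
  | .loop _ c => c.bound

/-- Only writes matter here, so `Prog.bound` ignores registers that are merely tested or used as
questions. -/
theorem Exec.eq_of_bound_le {O : List Bool → List Bool} {c : Prog} {s s' : State} {t : ℕ}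
    (h : Exec O c s t s') {r : ℕ} (hr : c.bound ≤ r) : s' r = s r := by
  induction h with
  | skip | loopDone => rfl
  | push r' | pop r' | query q r' =>
    simp only [Prog.bound] at hr
    rw [Function.update_of_ne (by omega)]
  | seq _ _ ih ih' =>
    simp only [Prog.bound] at hr
    rw [ih' (by omega), ih (by omega)]
  | casesNil _ _ ih | casesFalse _ _ ih | casesTrue _ _ ih =>
    simp only [Prog.bound] at hr
    exact ih (by omega)
  | loopStep _ _ _ ih ih' => rw [ih' hr, ih hr]

/-- Empty the registers `1, …, m`. -/
def clearAll : ℕ → Prog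
  | 0 => .skip
  | m + 1 => .seq (clearAll m) (clear (m + 1))

theorem runs_clearAll {O : List Bool → List Bool} (m : ℕ) (s : State) {L : ℕ}
    (hL : ∀ r, (s r).length ≤ L) : Runs O (clearAll m) s (m * (4 * L + 1) + 1)
      (fun r => if 1 ≤ r ∧ r ≤ m then [] else s r) := by
  induction m with
  | zero =>
    have : (fun r => if 1 ≤ r ∧ r ≤ 0 then [] else s r) = s := by
      funext r
      rw [if_neg (by omega)]
    rw [this]
    exact (runs_skip s).mono (by omega)
  | succ m ih =>
    have h := ih.seq (runs_clear (m + 1) _)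
    have hm := hL (m + 1)
    have : Function.update (fun r => if 1 ≤ r ∧ r ≤ m then [] else s r) (m + 1) [] =
        fun r => if 1 ≤ r ∧ r ≤ m + 1 then [] else s r := by
      funext r
      by_cases hr : r = m + 1
      · simp [hr]
      · have : (1 ≤ r ∧ r ≤ m + 1) ↔ (1 ≤ r ∧ r ≤ m) := by omega
        simp [hr, this]
    rw [this] at h
    refine h.mono ?_
    rw [if_neg (by omega)]
    nlinarith

/-- The class that consists of the trivial oracle only. -/
def plain : ℕ[X] → Set (List Bool → List Bool) := fun _ => {noOracle}

theorem PolyTimePred.polyTime {V : List Bool → List Bool → Bool} (h : PolyTimePred V) :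
    PolyTime plain fun _ (p : List Bool × List Bool) => V p.1 p.2 := by
  obtain ⟨P, T, hT⟩ := h
  -- `P` may leave garbage behind, which must be cleared for composition. The `+ 1` ensures that
  -- register `1`, which holds `y`, is cleared even if `P` never writes to it.
  refine ⟨.seq unpairProg (.seq P (clearAll (P.bound + 1))), fun q =>
    ⟨C 40 * X + C 40 + T + C (P.bound + 1) * (C 4 * (X + T) + C 1), ?_⟩⟩
  rintro O (rfl : O = noOracle) ⟨x, y⟩
  obtain ⟨t, s, ht, e, hs⟩ := hT x y
  have hle : x.length + y.length ≤ (enc (x, y)).length := by simp [length_pair]; omega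
  have hT' := eval_le_eval T hle
  have hun := runs_unpair (O := noOracle) (enc (x, y))
  simp only [enc_prod, unpair_pair, enc_list] at hun
  rw [← input₂_eq_st x y] at hun
  have hcl := runs_clearAll (O := noOracle) (P.bound + 1) s
    (L := (enc (x, y)).length + T.eval (enc (x, y)).length) (fun r => by
      have := e.length_le r
      have : (input₂ x y r).length ≤ x.length + y.length := by
        unfold input₂; split_ifs <;> simp
      omega)
  have hP : Runs noOracle P (input₂ x y) (T.eval (enc (x, y)).length) s :=
    ⟨t, ht.trans hT', e⟩
  have hs' : (fun r => if 1 ≤ r ∧ r ≤ P.bound + 1 then [] else s r) = input [V x y] := by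
    funext r
    by_cases h0 : r = 0
    · simp [h0, input, hs]
    · by_cases h1 : r ≤ P.bound + 1
      · simp [input, h0, h1]
      · rw [if_neg (by omega), e.eq_of_bound_le (by omega)]
        simp [input, input₂, h0]; omega
  rw [hs'] at hcl
  rw [input_eq_st]
  refine (hun.seq (hP.seq hcl)).mono ?_
  simp
  omega

theorem PolyTime.exists_prog {γ : Type} [Enc γ]
    {W : (List Bool → List Bool) → γ × List Bool → Bool} (h : PolyTime plain W) :
    ∃ (P : Prog) (T : ℕ[X]), ∀ w y, Runs noOracle P (input₂ (enc w) y)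
      (T.eval ((enc w).length + y.length)) (input [W noOracle (w, y)]) := by
  obtain ⟨P, hP⟩ := h
  obtain ⟨T, hT⟩ := hP 0
  refine ⟨.seq pairProg P, C 25 * X + C 13 + T.comp (C 2 * X + C 1), fun w y => ?_⟩
  have h := hT noOracle rfl (w, y)
  rw [input_eq_st] at h
  rw [input₂_eq_st]
  refine ((runs_pair _ _).seq h).mono ?_
  have := eval_le_eval T (show (enc (w, y)).length ≤ 2 * ((enc w).length + y.length) + 1 by
    simp [length_pair]; omega)
  simp at *
  omega

/-! ### Folds with bounded growth and unary arithmetic -/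

namespace PolyTime

variable {α σ : Type} [Enc α] [Enc σ] {𝓖 : ℕ[X] → Set (List Bool → List Bool)}

theorem foldl_const {f : (List Bool → List Bool) → σ → Bool → σ}
    {i : (List Bool → List Bool) → α → σ} {l : (List Bool → List Bool) → α → List Bool}
    (hf : ∀ b, PolyTime 𝓖 fun O s => f O s b) (k : ℕ)
    (hB : ∀ O s b, (enc (f O s b)).length ≤ (enc s).length + k)
    (hi : PolyTime 𝓖 i) (hl : PolyTime 𝓖 l) :
    PolyTime 𝓖 fun O a => (l O a).foldl (f O) (i O a) :=
  foldl (f := fun O (_ : List Bool) => f O) (fun b => (hf b).comp (snd .id))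
    (fun _ => ⟨C k, fun O _ _ s b => by simpa using hB O s b⟩) nil hi hl

theorem reverse {l : (List Bool → List Bool) → α → List Bool} (hl : PolyTime 𝓖 l) :
    PolyTime 𝓖 fun O a => (l O a).reverse := by
  have := foldl_const (f := fun _ s b => b :: s) (fun b => consBit b .id) 1 (by simp) nil hl
  simpa using this

theorem isEmpty {l : (List Bool → List Bool) → α → List Bool} (hl : PolyTime 𝓖 l) :
    PolyTime 𝓖 fun O a => (l O a).isEmpty := by
  have := foldl_const (f := fun _ (_ _ : Bool) => false) (fun b => constBool _) 0 (by simp)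
    (constBool true) hl
  have key : ∀ l : List Bool, l.foldl (fun _ _ => false) true = l.isEmpty := by
    rintro (_ | ⟨b, l⟩)
    · rfl
    · induction l <;> simp_all
  simpa only [key] using this

/-! ### Unary arithmetic -/

theorem foldl_push_unary (u : List Bool) (n : ℕ) :
    u.foldl (fun s _ => true :: s) (unary n) = unary (u.length + n) := by
  induction u generalizing n with
  | nil => simp
  | cons b u ih =>
    rw [List.foldl_cons, show true :: unary n = unary (n + 1) from rfl, ih, List.length_cons]
    congr 1
    omega

@[simp] theorem length_unary (n : ℕ) : (unary n).length = n := by simp [unary]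

theorem unary_add {m n : (List Bool → List Bool) → α → ℕ} (hm : PolyTime 𝓖 fun O a => unary (m O a))
    (hn : PolyTime 𝓖 fun O a => unary (n O a)) :
    PolyTime 𝓖 fun O a => unary (m O a + n O a) := by
  have := foldl_const (f := fun _ s _ => true :: s) (fun b => consBit _ .id) 1 (by simp) hn hm
  simpa only [foldl_push_unary, length_unary] using this

theorem unary_length {l : (List Bool → List Bool) → α → List Bool} (hl : PolyTime 𝓖 l) :
    PolyTime 𝓖 fun O a => unary (l O a).length := by
  have := foldl_const (f := fun _ s _ => true :: s) (fun b => consBit _ .id) 1 (by simp)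
    (const (unary 0)) hl
  simpa only [foldl_push_unary, add_zero] using this

theorem unary_mul {m n : (List Bool → List Bool) → α → ℕ} (hm : PolyTime 𝓖 fun O a => unary (m O a))
    (hn : PolyTime 𝓖 fun O a => unary (n O a)) :
    PolyTime 𝓖 fun O a => unary (m O a * n O a) := by
  have := foldl (f := fun _ c s _ => List.foldl (fun s _ => true :: s) s c)
    (fun b => foldl_const (f := fun _ s _ => true :: s) (fun b => consBit _ .id) 1 (by simp)
      (snd .id) (fst .id)) (fun q => ⟨X, by simp [add_comm]⟩) hn (const (unary 0)) hm
  have key : ∀ (u : List Bool) (n k : ℕ),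
      u.foldl (fun s _ => (unary n).foldl (fun s _ => true :: s) s) (unary k) =
        unary (u.length * n + k) := by
    intro u n
    induction u with
    | nil => simp
    | cons b u ih =>
      intro k
      rw [List.foldl_cons, foldl_push_unary, ih, List.length_cons, length_unary]
      congr 1
      ring
  simpa only [key, length_unary, add_zero] using this

/-- Instances carry the number of variables and the time bound in unary, and both are polynomials in
lengths. -/
theorem unary_eval (p : ℕ[X]) {n : (List Bool → List Bool) → α → ℕ}
    (hn : PolyTime 𝓖 fun O a => unary (n O a)) :
    PolyTime 𝓖 fun O a => unary (p.eval (n O a)) := by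
  induction p using Polynomial.induction_on with
  | C k => simpa using const (unary k)
  | add p q hp hq => simpa using unary_add hp hq
  | monomial i k h => simpa [pow_succ, ← mul_assoc] using unary_mul h hn

end PolyTime

/-! ### Binary arithmetic -/

/-- The number with given binary digits, least significant first. -/
def binVal : List Bool → ℕ
  | [] => 0
  | b :: l => b.toNat + 2 * binVal l

theorem binVal_lt (l : List Bool) : binVal l < 2 ^ l.length := by
  induction l with
  | nil => simp [binVal]
  | cons b l ih =>
    have := b.toNat_lt
    simp only [binVal, List.length_cons, pow_succ]
    omega

theorem binVal_append (l m : List Bool) :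
    binVal (l ++ m) = binVal l + 2 ^ l.length * binVal m := by
  induction l with
  | nil => simp [binVal]
  | cons b l ih =>
    simp only [binVal, List.cons_append, List.length_cons, pow_succ, ih]
    ring

theorem binVal_replicate_false (n : ℕ) : binVal (List.replicate n false) = 0 := by
  induction n with
  | zero => rfl
  | succ n ih => simp [List.replicate_succ, binVal, ih]

theorem binVal_bits (n : ℕ) : binVal n.bits = n := by
  induction n using Nat.binaryRec' with
  | zero => simp [binVal]
  | bit b n h ih =>
    rw [Nat.bits_append_bit _ _ h, binVal, ih]
    cases b <;> simp [Nat.bit]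
    omega

theorem bits_two_mul_add (b : Bool) (n : ℕ) :
    (b.toNat + 2 * n).bits = bif b || !n.bits.isEmpty then b :: n.bits else [] := by
  rcases Nat.eq_zero_or_pos n with rfl | hn
  · cases b <;> simp
  · have : n.bits.isEmpty = false := by
      rw [← Bool.not_eq_true, List.isEmpty_iff]
      intro h
      have := binVal_bits n
      rw [h, binVal] at this
      omega
    rw [this, show b.toNat + 2 * n = Nat.bit b n by cases b <;> simp [Nat.bit]; omega,
      Nat.bits_append_bit _ _ (by omega)]
    simp

/-- The normal form of a binary number, given by its digits with the most significant first. -/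
def normBits (o : List Bool) : List Bool :=
  o.foldl (fun s b => bif b || !s.isEmpty then b :: s else []) []

/-- `Nat.bits` has no leading zeros, so computed digits must be normalized to match `encodeInt`
literally. -/
theorem normBits_eq (o : List Bool) : normBits o = (binVal o.reverse).bits := by
  induction o using List.reverseRecOn with
  | nil => simp [normBits, binVal]
  | append_singleton o b ih =>
    rw [normBits, List.foldl_append, List.foldl_cons, List.foldl_nil, ← normBits, ih,
      List.reverse_append, List.reverse_singleton, List.singleton_append, binVal, bits_two_mul_add]

theorem length_normBits_le (o : List Bool) : (normBits o).length ≤ o.length := by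
  induction o using List.reverseRecOn with
  | nil => simp [normBits]
  | append_singleton o b ih =>
    rw [normBits, List.foldl_append, List.foldl_cons, List.foldl_nil, ← normBits]
    cases h : b || !(normBits o).isEmpty <;> simp
    exact ih

/-- One digit of an addition (`m = false`) or subtraction (`m = true`): the state consists of the
remaining digits of the second operand, the carry, and the reversed result. -/
def arithStep (m : Bool) (s : List Bool × Bool × List Bool) (b : Bool) :
    List Bool × Bool × List Bool :=
  (s.1.tail, Bool.atLeastTwo (b ^^ m) (s.1.headD false) s.2.1,
    (b ^^ (s.1.headD false ^^ s.2.1)) :: s.2.2)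

/-- Addition (`m = false`) or subtraction (`m = true`) of binary numbers: the final carry, and the
digits of the result with the most significant first. -/
def arith (m : Bool) (x y : List Bool) : Bool × List Bool :=
  ((true :: y).foldl (fun s _ => arithStep m s false) (x.foldl (arithStep m) (y, false, []))).2

/-- The loop invariant: the digits already written, together with the unread part of the second
operand and the carry (or borrow) at the current place value, represent the exact result. The borrow
of a subtraction is the majority with the first bit negated. -/
theorem foldl_arithStep (m : Bool) (l : List Bool) (s : List Bool × Bool × List Bool) :
    (l.foldl (arithStep m) s).1 = s.1.drop l.length ∧
    (l.foldl (arithStep m) s).2.2.length = s.2.2.length + l.length ∧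
    (binVal (l.foldl (arithStep m) s).2.2.reverse : ℤ) = binVal s.2.2.reverse +
      2 ^ s.2.2.length * (binVal l + (bif m then -1 else 1) * (binVal s.1 + s.2.1.toNat)) -
      2 ^ (s.2.2.length + l.length) * (bif m then -1 else 1) *
        (binVal (s.1.drop l.length) + (l.foldl (arithStep m) s).2.1.toNat) := by
  induction l generalizing s with
  | nil =>
    simp [binVal]
    ring
  | cons b l ih =>
    obtain ⟨h₁, h₂, h₃⟩ := ih (arithStep m s b)
    obtain ⟨y, c, o⟩ := s
    have hy : (binVal y : ℤ) = (y.headD false).toNat + 2 * binVal y.tail := by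
      cases y <;> simp [binVal]
    refine ⟨?_, ?_, ?_⟩
    · rw [List.foldl_cons, h₁]
      simp [arithStep, List.drop_tail]
    · rw [List.foldl_cons, h₂]
      simp [arithStep]; omega
    · rw [List.foldl_cons, h₃]
      simp only [arithStep, List.length_cons, List.reverse_cons, binVal_append, binVal,
        List.length_reverse, List.drop_tail, hy, add_comm l.length 1]
      push_cast
      rw [show o.length + 1 + l.length = o.length + (1 + l.length) by ring]
      generalize y.headD false = h
      cases m <;> cases b <;> cases c <;> cases h <;> simp [Bool.atLeastTwo] <;> ring

/-- After `x`, zeros are fed in, one more than `y` has digits; the list `true :: y` serves only for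
its length. This exhausts `y` and leaves room for a carry. -/
theorem arith_spec (m : Bool) (x y : List Bool) :
    (arith m x y).2.length = x.length + y.length + 1 ∧
    (binVal (arith m x y).2.reverse : ℤ) = binVal x + (bif m then -1 else 1) * binVal y -
      (bif m then -1 else 1) * 2 ^ (x.length + y.length + 1) * (arith m x y).1.toNat := by
  have key : ∀ (u : List Bool) s, u.foldl (fun s _ => arithStep m s false) s =
      (List.replicate u.length false).foldl (arithStep m) s := by
    intro u
    induction u with
    | nil => simp
    | cons b u ih => intro s; simp [ih, List.replicate_succ]
  have h : arith m x y = ((x ++ List.replicate (true :: y).length false).foldl (arithStep m)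
      (y, false, [])).2 := by
    rw [arith, key, List.foldl_append]
  obtain ⟨-, h₂, h₃⟩ :=
    foldl_arithStep m (x ++ List.replicate (true :: y).length false) (y, false, [])
  rw [← h] at h₂ h₃
  rw [List.drop_eq_nil_of_le (by simp; omega)] at h₃
  simp [binVal_append, binVal_replicate_false, binVal] at h₂ h₃
  refine ⟨by omega, ?_⟩
  rw [h₃, add_assoc x.length]
  ring

/-- Comparison of binary numbers. -/
def binLt (x y : List Bool) : Bool := (arith true x y).1

theorem binLt_eq (x y : List Bool) : binLt x y = decide (binVal x < binVal y) := by
  obtain ⟨h₁, h₂⟩ := arith_spec true x y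
  have h₃ := binVal_lt (arith true x y).2.reverse
  rw [List.length_reverse, h₁] at h₃
  zify at h₃
  rw [binLt]
  rw [h₂] at h₃
  have h₄ : (0 : ℤ) ≤ binVal (arith true x y).2.reverse := by positivity
  rw [h₂] at h₄
  -- The digits represent a number in `[0, 2 ^ length)`, so the final borrow is set exactly when the
  -- difference is negative.
  cases h : (arith true x y).1 <;> rw [h] at h₃ h₄ <;> simp at h₃ h₄ ⊢ <;> omega

/-- Subtraction of binary numbers. -/
def binSub (x y : List Bool) : List Bool := normBits (arith true x y).2

theorem binSub_eq {x y : List Bool} (h : binVal y ≤ binVal x) :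
    binSub x y = (binVal x - binVal y).bits := by
  have h' : (arith true x y).1 = false := by
    have := binLt_eq x y
    rwa [decide_eq_false (by omega)] at this
  obtain ⟨-, h₂⟩ := arith_spec true x y
  rw [binSub, normBits_eq]
  congr 1
  simp [h'] at h₂
  omega

/-- Addition of binary numbers. -/
def binAdd (x y : List Bool) : List Bool := normBits (arith false x y).2

theorem binAdd_eq (x y : List Bool) : binAdd x y = (binVal x + binVal y).bits := by
  obtain ⟨h₁, h₂⟩ := arith_spec false x y
  have h₄ : (0 : ℤ) ≤ binVal (arith false x y).2.reverse := by positivity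
  rw [h₂] at h₄
  have hx := binVal_lt x
  have hy := binVal_lt y
  have hx' : 2 ^ x.length ≤ 2 ^ (x.length + y.length) := Nat.pow_le_pow_right (by simp) (by omega)
  have hy' : 2 ^ y.length ≤ 2 ^ (x.length + y.length) := Nat.pow_le_pow_right (by simp) (by omega)
  have h' : binVal x + binVal y < 2 ^ (x.length + y.length + 1) := by
    rw [pow_succ]
    omega
  zify at h'
  rw [binAdd, normBits_eq]
  congr 1
  cases h : (arith false x y).1 <;> simp [h] at h₂ h₄ <;> omega

theorem length_binAdd_le (x y : List Bool) :
    (binAdd x y).length ≤ x.length + y.length + 1 :=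
  (length_normBits_le _).trans (arith_spec false x y).1.le

/-- Multiplication of binary numbers. -/
def binMul (x y : List Bool) : List Bool :=
  x.reverse.foldl (fun s b => binAdd (false :: s) (bif b then y else [])) []

/-- This is Horner's scheme, starting from the most significant digit of `x`. -/
theorem binVal_binMul (x y : List Bool) : binVal (binMul x y) = binVal x * binVal y := by
  rw [binMul, List.foldl_reverse]
  induction x with
  | nil => simp [binVal]
  | cons b x ih =>
    rw [List.foldr_cons, binAdd_eq, binVal_bits, binVal, ih, binVal]
    cases b <;> simp [binVal] <;> ring

/-- The difference of two binary numbers, as a signed binary number. -/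
def signedSub (x y : List Bool) : List Bool :=
  bif binLt x y then true :: binSub y x else false :: binSub x y

theorem signedSub_eq (x y : List Bool) :
    signedSub x y = encodeInt ((binVal x : ℤ) - binVal y) := by
  rw [signedSub, binLt_eq, encodeInt]
  by_cases h : binVal x < binVal y
  · rw [decide_eq_true h, decide_eq_true (by omega), cond_true, binSub_eq h.le]
    congr 2
    omega
  · rw [decide_eq_false h, decide_eq_false (by omega), cond_false, binSub_eq (by omega)]
    congr 2
    omega

/-- The numerator of a fraction, replaced by zero if it is negative. -/
def fracNum (z : List Bool) : List Bool :=
  bif (unpair z).1.headD false then [] else (unpair z).1.tail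

/-- Comparison of fractions, where negative ones are replaced by zero. -/
def fracLe (z z' : List Bool) : Bool :=
  !binLt (binMul (fracNum z') (unpair z).2) (binMul (fracNum z) (unpair z').2)

theorem binVal_fracNum (a : ℤ) (d : ℕ) : (binVal (fracNum (encodeFrac a d)) : ℤ) = max a 0 := by
  simp only [fracNum, encodeFrac, unpair_pair, encodeInt, List.headD_cons, List.tail_cons]
  by_cases h : a < 0
  · simp [h, binVal, h.le]
  · simp only [h, decide_false, cond_false, binVal_bits]
    omega

theorem fracLe_encodeFrac (a a' : ℤ) (d d' : ℕ) :
    fracLe (encodeFrac a d) (encodeFrac a' d') = true ↔ max a 0 * d' ≤ max a' 0 * d := by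
  rw [fracLe, binLt_eq, Bool.not_eq_true', decide_eq_false_iff_not, not_lt, binVal_binMul,
    binVal_binMul, ← Nat.cast_le (α := ℤ)]
  push_cast
  rw [binVal_fracNum, binVal_fracNum]
  simp [encodeFrac, binVal_bits]

/-! ### Polynomial-time bounds for binary arithmetic -/

namespace PolyTime

variable {α : Type} [Enc α] {𝓖 : ℕ[X] → Set (List Bool → List Bool)}
  {x y : (List Bool → List Bool) → α → List Bool}

theorem normBits (hx : PolyTime 𝓖 x) : PolyTime 𝓖 fun O a => normBits (x O a) :=
  foldl_const (f := fun _ (s : List Bool) b => bif b || !s.isEmpty then b :: s else [])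
    (fun b => cond (bit (fun e => b || !e) (isEmpty .id)) (consBit b .id) nil) 1
    (fun O s b => by cases b || !s.isEmpty <;> simp) nil hx

theorem arithStep (m b : Bool) :
    PolyTime 𝓖 fun _ (s : List Bool × Bool × List Bool) => arithStep m s b :=
  prodMk (tail (fst .id)) (prodMk
    (bit₂ (fun h c => Bool.atLeastTwo (b ^^ m) h c) (headD (fst .id)) (fst (snd .id)))
    (cons (bit₂ (fun h c => b ^^ (h ^^ c)) (headD (fst .id)) (fst (snd .id))) (snd (snd .id))))

theorem length_arithStep_le (m b : Bool) (s : List Bool × Bool × List Bool) :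
    (enc (NGap.arithStep m s b)).length ≤ (enc s).length + 1 := by
  simp [NGap.arithStep, length_pair]
  omega

theorem arith (m : Bool) (hx : PolyTime 𝓖 x) (hy : PolyTime 𝓖 y) :
    PolyTime 𝓖 fun O a => arith m (x O a) (y O a) :=
  snd (foldl_const (f := fun _ s _ => NGap.arithStep m s false) (fun _ => arithStep m false) 1
    (fun _ s _ => length_arithStep_le m false s)
    (foldl_const (f := fun _ => NGap.arithStep m) (fun b => arithStep m b) 1
      (fun _ s b => length_arithStep_le m b s) (prodMk hy (prodMk (constBool false) nil)) hx)
    (consBit true hy))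

theorem binLt (hx : PolyTime 𝓖 x) (hy : PolyTime 𝓖 y) :
    PolyTime 𝓖 fun O a => binLt (x O a) (y O a) := (arith true hx hy).fst

theorem binSub (hx : PolyTime 𝓖 x) (hy : PolyTime 𝓖 y) :
    PolyTime 𝓖 fun O a => binSub (x O a) (y O a) := (arith true hx hy).snd.normBits

theorem binAdd (hx : PolyTime 𝓖 x) (hy : PolyTime 𝓖 y) :
    PolyTime 𝓖 fun O a => binAdd (x O a) (y O a) := (arith false hx hy).snd.normBits

theorem binMul (hx : PolyTime 𝓖 x) (hy : PolyTime 𝓖 y) :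
    PolyTime 𝓖 fun O a => binMul (x O a) (y O a) :=
  foldl (f := fun _ y s b => NGap.binAdd (false :: s) (bif b then y else []))
    (fun b => binAdd (consBit false (snd .id)) (cond (constBool b) (fst .id) nil))
    (fun q => ⟨X + C 2, fun O _ y s b => by
      have := length_binAdd_le (false :: s) (bif b then y else [])
      cases b <;> simp at * <;> omega⟩) hy nil hx.reverse

theorem signedSub (hx : PolyTime 𝓖 x) (hy : PolyTime 𝓖 y) :
    PolyTime 𝓖 fun O a => signedSub (x O a) (y O a) :=
  cond (binLt hx hy) (consBit true (binSub hy hx)) (consBit false (binSub hx hy))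

theorem fracNum (hx : PolyTime 𝓖 x) : PolyTime 𝓖 fun O a => fracNum (x O a) :=
  cond hx.unpairFst.headD nil hx.unpairFst.tail

theorem fracLe (hx : PolyTime 𝓖 x) (hy : PolyTime 𝓖 y) :
    PolyTime 𝓖 fun O a => fracLe (x O a) (y O a) :=
  bit _ (binLt (binMul hy.fracNum hx.unpairSnd) (binMul hx.fracNum hy.unpairSnd))

end PolyTime

/-! ### Counting strings -/

/-- The number of strings of length `n` that satisfy `U`. -/
def count (U : List Bool → Bool) : ℕ → ℕ
  | 0 => (U []).toNat
  | n + 1 => count (fun l => U (false :: l)) n + count (fun l => U (true :: l)) n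

theorem card_eq_count (U : List Bool → Bool) (n : ℕ) :
    Fintype.card {y : Fin n → Bool // U (List.ofFn y) = true} = count U n := by
  rw [Fintype.card_subtype]
  induction n generalizing U with
  | zero => cases h : U [] <;> simp [count, h]
  | succ n ih =>
    rw [count, ← ih, ← ih, ← Finset.card_filter_add_card_filter_not (p := fun y => y 0 = false)]
    have key : ∀ b : Bool, (Finset.univ.filter fun y : Fin (n + 1) → Bool =>
        U (List.ofFn y) = true ∧ y 0 = b).card =
        (Finset.univ.filter fun y : Fin n → Bool => U (b :: List.ofFn y) = true).card := by
      intro b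
      symm
      refine Finset.card_bij (fun y _ => Fin.cons b y) ?_ ?_ ?_
      · intro y hy
        simpa [List.ofFn_succ] using hy
      · intro y _ y' _ h
        exact (Fin.cons_inj.1 h).2
      · intro y hy
        refine ⟨Fin.tail y, ?_, ?_⟩
        · simp only [Finset.mem_filter, Finset.mem_univ, true_and] at hy ⊢
          rw [← hy.1, ← hy.2, List.ofFn_succ]
          rfl
        · simp only [Finset.mem_filter, Finset.mem_univ, true_and] at hy
          rw [← hy.2, Fin.cons_self_tail]
    rw [Finset.filter_filter, Finset.filter_filter]
    simp only [Bool.not_eq_false]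
    rw [key, key]

theorem count_false (n : ℕ) : count (fun _ => false) n = 0 := by
  induction n with
  | zero => rfl
  | succ n ih => simp [count, ih]

theorem count_not (U : List Bool → Bool) (n : ℕ) :
    count (fun l => !U l) n + count U n = 2 ^ n := by
  induction n generalizing U with
  | zero => cases h : U [] <;> simp [count, h]
  | succ n ih =>
    have h₁ := ih fun l => U (false :: l)
    have h₂ := ih fun l => U (true :: l)
    simp only [count, pow_succ]
    omega

theorem count_true (n : ℕ) : count (fun _ => true) n = 2 ^ n := by
  simpa [count_false] using count_not (fun _ => false) n

theorem count_le (U : List Bool → Bool) (n : ℕ) : count U n ≤ 2 ^ n := by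
  have := count_not U n
  omega

theorem gap_eq_count (U : List Bool → Bool) (n : ℕ) :
    gap (fun y : Fin n → Bool => U (List.ofFn y)) = 2 * (count U n : ℤ) - 2 ^ n := by
  have h := count_not U n
  have h₂ := card_eq_count (fun l => !U l) n
  simp only [Bool.not_eq_true'] at h₂
  rw [gap, card_eq_count, h₂]
  zify at h
  linarith

/-- Whether all bits are `false`. -/
def allFalse (l : List Bool) : Bool := l.foldl (fun s b => s && !b) true

theorem allFalse_false (l : List Bool) : allFalse (false :: l) = allFalse l := rfl

theorem allFalse_true (l : List Bool) : allFalse (true :: l) = false := by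
  rw [allFalse]
  induction l <;> simp_all

theorem count_allFalse (n : ℕ) : count allFalse n = 1 := by
  induction n with
  | zero => rfl
  | succ n ih => simp [count, allFalse_false, allFalse_true, ih, count_false]

/-- The part of `l` after the length of `u`, and the part before it, reversed. -/
def splitRev (u l : List Bool) : List Bool × List Bool :=
  u.foldl (fun s _ => (s.1.tail, s.1.headD false :: s.2)) (l, [])

theorem splitRev_eq (u v l : List Bool) (h : u.length = v.length) :
    splitRev u (v ++ l) = (l, v.reverse) := by
  have key : ∀ (v u m : List Bool), u.length = v.length →
      u.foldl (fun s _ => (s.1.tail, s.1.headD false :: s.2)) (v ++ l, m) =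
        (l, v.reverse ++ m) := by
    intro v
    induction v with
    | nil => simp +contextual
    | cons b v ih =>
      rintro (_ | ⟨c, u⟩) m h
      · simp at h
      · simpa using ih u (b :: m) (by simpa using h)
  simpa [splitRev] using key v u [] h

/-- The predicate `V`, extended to longer strings: the bits after the length of `u` must be
`false`. -/
def padded (u : List Bool) (V : List Bool → Bool) (l : List Bool) : Bool :=
  V (splitRev u l).2.reverse && allFalse (splitRev u l).1

/-- Each string of the original length has a unique admissible extension. Padding brings the
witnesses of both #P functions to a common length. -/
theorem count_padded (u : List Bool) (V : List Bool → Bool) (m : ℕ) :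
    count (padded u V) (u.length + m) = count V u.length := by
  have key : ∀ (n : ℕ) (v : List Bool), n + v.length = u.length →
      count (fun l => padded u V (v ++ l)) (n + m) = count (fun l => V (v ++ l)) n := by
    intro n
    induction n with
    | zero =>
      intro v hv
      have : (fun l => padded u V (v ++ l)) = fun l => V v && allFalse l := by
        funext l
        rw [padded, splitRev_eq u v l (by omega)]
        simp
      rw [this, zero_add]
      cases h : V v <;> simp [count, h, count_false, count_allFalse]
    | succ n ih =>
      intro v hv
      have h₁ := ih (v ++ [false]) (by simp; omega)
      have h₂ := ih (v ++ [true]) (by simp; omega)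
      simp only [List.append_assoc, List.singleton_append] at h₁ h₂
      rw [add_right_comm, count, count, h₁, h₂]
  simpa using key u.length [] (by simp)

/-- The bit of `l` at the position of the first `true` in `z`, and `false` if there is none. -/
def lookup (l z : List Bool) : Bool :=
  (fun s => s.1 && s.2.headD false)
    (z.foldl (fun s b => bif s.1 then s else bif b then (true, s.2) else (false, s.2.tail))
      (false, l))

theorem lookup_false (l z : List Bool) : lookup l (false :: z) = lookup l.tail z := rfl

theorem lookup_true (l z : List Bool) : lookup l (true :: z) = l.headD false := by
  have : ∀ z : List Bool, z.foldl (fun (s : Bool × List Bool) b =>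
      bif s.1 then s else bif b then (true, s.2) else (false, s.2.tail)) (true, l) = (true, l) := by
    intro z
    induction z <;> simp_all
  rw [lookup, List.foldl_cons]
  simp only [cond_true, cond_false]
  rw [this]
  rfl

theorem count_lookup_nil (n : ℕ) : count (lookup []) n = 0 := by
  induction n with
  | zero => rfl
  | succ n ih => simp [count, lookup_false, lookup_true, ih, count_false]

/-- Strings whose first `true` is at position `i` have all later bits free, so their number halves
with each position, like the place values of digits read from the most significant one. Each digit
of `l` thus contributes its value times `2 ^ m`. -/
theorem count_lookup (l : List Bool) (m : ℕ) :
    count (lookup l.reverse) (l.length + m) = binVal l * 2 ^ m := by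
  induction l using List.reverseRecOn with
  | nil => simp [count_lookup_nil, binVal]
  | append_singleton l b ih =>
    rw [List.length_append, List.length_singleton, add_right_comm, count]
    simp only [List.reverse_append, List.reverse_singleton, List.singleton_append, lookup_false,
      lookup_true, List.tail_cons, List.headD_cons]
    rw [ih, binVal_append]
    cases b <;> simp [count_false, count_true, binVal, pow_add]
    ring

/-! ### The instances asked by the reduction -/

/-- The Boolean function of an instance: the first bit is a sign, the second one chooses between
witnesses and digits. -/
def instFn (A B : List Bool → Bool) (P Q : List Bool) (y : List Bool) : Bool :=
  y.headD false ^^ bif y.tail.headD false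
    then bif y.headD false then lookup P y.tail.tail else lookup Q y.tail.tail
    else bif y.headD false then B y.tail.tail else A y.tail.tail

/-- The four blocks accept `A`, `lookup Q` and the complements of `B` and `lookup P`. The two
complements contribute `2 * 2 ^ n` to the count, which cancels the constant term of the gap. -/
theorem gap_instFn (A B : List Bool → Bool) (P Q : List Bool) (n : ℕ) :
    gap (fun y : Fin (n + 2) → Bool => instFn A B P Q (List.ofFn y)) =
      2 * ((count A n : ℤ) - count B n - (count (lookup P) n - count (lookup Q) n)) := by
  rw [gap_eq_count]
  have h₁ := count_not B n
  have h₂ := count_not (lookup P) n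
  zify at h₁ h₂
  simp only [count, instFn, List.headD_cons, List.tail_cons, cond_true, cond_false, Bool.false_bne,
    Bool.true_bne]
  push_cast
  rw [pow_add]
  linarith

/-! ### Polynomial-time bounds for the counting predicates -/

namespace PolyTime

variable {α : Type} [Enc α] {𝓖 : ℕ[X] → Set (List Bool → List Bool)}
  {u l : (List Bool → List Bool) → α → List Bool}

theorem allFalse (hl : PolyTime 𝓖 l) : PolyTime 𝓖 fun O a => allFalse (l O a) :=
  foldl_const (f := fun _ s b => s && !b) (fun b => bit (fun s => s && !b) .id) 1 (by simp)
    (constBool true) hl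

theorem splitRev (hu : PolyTime 𝓖 u) (hl : PolyTime 𝓖 l) :
    PolyTime 𝓖 fun O a => splitRev (u O a) (l O a) :=
  foldl_const (f := fun _ (s : List Bool × List Bool) _ => (s.1.tail, s.1.headD false :: s.2))
    (fun b => prodMk (tail (fst .id)) (cons (headD (fst .id)) (snd .id))) 1
    (fun _ s _ => by simp [length_pair]; omega) (prodMk hl nil) hu

theorem lookup (hu : PolyTime 𝓖 u) (hl : PolyTime 𝓖 l) :
    PolyTime 𝓖 fun O a => lookup (u O a) (l O a) := by
  have h := foldl_const (𝓖 := 𝓖) (f := fun _ (s : Bool × List Bool) b =>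
      bif s.1 then s else bif b then (true, s.2) else (false, s.2.tail))
    (fun b => cond (fst .id) .id (cond (constBool b) (prodMk (constBool true) (snd .id))
      (prodMk (constBool false) (tail (snd .id))))) 0
    (fun _ s b => by rcases s with ⟨_ | _, s⟩ <;> cases b <;> simp [length_pair])
    (prodMk (constBool false) hu) hl
  exact bit₂ (fun x y => x && y) h.fst h.snd.headD

end PolyTime

/-! ### Digit by digit search -/

/-- Approximations of the squares of `2 D / 2 ^ n` and `2 E / 2 ^ n` reveal which of the integers
`D` and `E` has the larger absolute value, up to a factor `√3`. -/
def Discriminates (approx : ℕ → ℝ → ℝ → Prop) : Prop :=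
  ∀ (n : ℕ) (D E : ℤ) (s s' : ℝ), approx n (((2 * D : ℤ) / 2 ^ n : ℝ) ^ 2) s →
    approx n (((2 * E : ℤ) / 2 ^ n : ℝ) ^ 2) s' → max s 0 ≤ max s' 0 → D ^ 2 ≤ 3 * E ^ 2

theorem discriminates_relApprox {ε : ℝ} (h₀ : 0 < ε) (h₁ : ε < 1 / 2) :
    Discriminates fun _ => RelApprox ε := by
  rintro n D E s s' ⟨hs, -⟩ ⟨hs₁, hs₂⟩ h
  have hs₀ : 0 ≤ s' := le_trans (mul_nonneg (by linarith) (sq_nonneg _)) hs₁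
  rw [max_eq_left hs₀] at h
  have h₂ := hs.trans ((le_max_left _ _).trans (h.trans hs₂))
  rw [div_pow, div_pow, ← mul_div_assoc, ← mul_div_assoc,
    div_le_div_iff_of_pos_right (by positivity)] at h₂
  push_cast at h₂
  -- Here `ε < 1 / 2` enters: `1 + ε ≤ 3 * (1 - ε)`.
  have h₃ : (1 - ε) * (D : ℝ) ^ 2 ≤ (1 - ε) * (3 * (E : ℝ) ^ 2) := by
    nlinarith [sq_nonneg (E : ℝ)]
  have h₄ := le_of_mul_le_mul_left h₃ (by linarith)
  exact_mod_cast h₄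

theorem discriminates_addApprox : Discriminates fun n => AddApprox (1 / 2 ^ (2 * n)) := by
  intro n D E s s' hs hs' h
  have h₁ := abs_le.1 hs
  have h₂ := abs_le.1 hs'
  have hpos : (0 : ℝ) < 2 ^ (2 * n) := by positivity
  rw [div_pow, ← pow_mul, mul_comm n 2] at h₁ h₂
  have h₃ : max s' 0 ≤ ((2 * E : ℤ) : ℝ) ^ 2 / 2 ^ (2 * n) + 1 / 2 ^ (2 * n) :=
    max_le (by linarith) (by positivity)
  have h₄ : ((2 * D : ℤ) : ℝ) ^ 2 / 2 ^ (2 * n) ≤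
      (((2 * E : ℤ) : ℝ) ^ 2 + 2) / 2 ^ (2 * n) := by
    have := (le_max_left s 0).trans (h.trans h₃)
    rw [add_div, show (2 : ℝ) / 2 ^ (2 * n) = 1 / 2 ^ (2 * n) + 1 / 2 ^ (2 * n) by ring]
    linarith
  rw [div_le_div_iff_of_pos_right hpos] at h₄
  have h₅ : (2 * D) ^ 2 ≤ (2 * E) ^ 2 + 2 := by exact_mod_cast h₄
  -- By integrality, `4 * D ^ 2 ≤ 4 * E ^ 2 + 2` leaves no room for `D ^ 2 > E ^ 2`; the factor 2 in
  -- the gap is essential.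
  have h₆ : D ^ 2 ≤ E ^ 2 := by
    rw [mul_pow, mul_pow] at h₅
    omega
  nlinarith [sq_nonneg E]

/-- The case where digit `1` beats `-1` and then loses to `0`. If `B ≤ -h`, then `B + h` is too
close to zero for `h₁`; if `B ≥ h`, then `B - h` is too close to zero for `h₂`. -/
theorem abs_lt_of_sq_le {B h : ℤ} (hB : |B| < 2 * h) (h₁ : (B - h) ^ 2 ≤ 3 * (B + h) ^ 2)
    (h₂ : B ^ 2 ≤ 3 * (B - h) ^ 2) : |B| < h := by
  rw [abs_lt] at *
  obtain ⟨hl, hu⟩ := hB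
  constructor
  · by_contra! hc
    nlinarith [mul_nonneg (show 0 ≤ -B - h by linarith) (show 0 ≤ 2 * h + B by linarith)]
  · by_contra! hc
    nlinarith [mul_nonneg (show 0 ≤ B - h by linarith) (show 0 ≤ 2 * h - B by linarith)]

/-- The case where digit `1` beats both `-1` and `0`; the claim amounts to `B > 0`. For `B ≤ 0`, the
first comparison forces `B ≥ -h / 2`, and then `0` is too much better than `1` for `h₂`. -/
theorem abs_sub_lt_of_sq_le {B h : ℤ} (hB : |B| < 2 * h) (h₁ : (B - h) ^ 2 ≤ 3 * (B + h) ^ 2)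
    (h₂ : (B - h) ^ 2 ≤ 3 * B ^ 2) : |B - h| < h := by
  rw [abs_lt] at *
  obtain ⟨hl, hu⟩ := hB
  refine ⟨?_, by linarith⟩
  by_contra! hc
  have h₃ : 0 ≤ h + 2 * B := by
    by_contra! h₄
    nlinarith [mul_nonneg (show 0 ≤ -B by linarith) (show 0 ≤ 2 * h + B by linarith)]
  nlinarith [mul_nonneg (show 0 ≤ -B by linarith) (show 0 ≤ h + B by linarith)]

/-- Append one signed digit to the number given by the positive digits `s.1` and the negative
digits `s.2`, comparing the answers to the questions about the three candidates. -/
def digitStep (ask : List Bool × List Bool → List Bool) (s : List Bool × List Bool) :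
    List Bool × List Bool :=
  (fun m => bif fracLe (ask (false :: s.1, false :: s.2)) (ask m)
    then (false :: s.1, false :: s.2) else m)
  (bif fracLe (ask (true :: s.1, false :: s.2)) (ask (false :: s.1, true :: s.2))
    then (true :: s.1, false :: s.2) else (false :: s.1, true :: s.2))

/-- Whatever the oracle answers, one digit is added to each list, so lengths are controlled without
any assumption on `ask`. -/
theorem digitStep_eq_or (ask : List Bool × List Bool → List Bool) (s : List Bool × List Bool) :
    ∃ b c, digitStep ask s = (b :: s.1, c :: s.2) := by
  unfold digitStep
  generalize fracLe (ask (true :: s.1, false :: s.2)) (ask (false :: s.1, true :: s.2)) = x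
  cases x <;> dsimp only [cond_true, cond_false] <;> generalize fracLe _ _ = y <;> cases y <;>
    simp

/-- The number given by positive and negative binary digits. -/
def diffVal (s : List Bool × List Bool) : ℤ := binVal s.1 - binVal s.2

/-- The answers `ask s` compare the distances of an integer `A` from `diffVal s * 2 ^ m`, for
numbers `s` with `N - m` digits. -/
def Compares (A : ℤ) (N : ℕ) (ask : List Bool × List Bool → List Bool) : Prop :=
  ∀ (m : ℕ) (s s' : List Bool × List Bool), s.1.length + m = N → s.2.length + m = N →
    s'.1.length + m = N → s'.2.length + m = N →
    (fracLe (ask s) (ask s') = true →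
      (A - diffVal s * 2 ^ m) ^ 2 ≤ 3 * (A - diffVal s' * 2 ^ m) ^ 2) ∧
    (fracLe (ask s) (ask s') = false →
      (A - diffVal s' * 2 ^ m) ^ 2 ≤ 3 * (A - diffVal s * 2 ^ m) ^ 2)

theorem Compares.abs_digitStep_lt {A : ℤ} {N : ℕ} {ask : List Bool × List Bool → List Bool}
    (h : Compares A N ask) {m : ℕ} {s : List Bool × List Bool} (h₁ : s.1.length + (m + 1) = N)
    (h₂ : s.2.length + (m + 1) = N) (hs : |A - diffVal s * 2 ^ (m + 1)| < 2 ^ (m + 1)) :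
    |A - diffVal (digitStep ask s) * 2 ^ m| < 2 ^ m := by
  obtain ⟨P, Q⟩ := s
  have hlen : ∀ (b : Bool) (l : List Bool), l.length + (m + 1) = N → (b :: l).length + m = N := by
    intro b l hl
    simp; omega
  have cmp := fun b c b' c' : Bool => h m (b :: P, c :: Q) (b' :: P, c' :: Q) (hlen _ _ h₁)
    (hlen _ _ h₂) (hlen _ _ h₁) (hlen _ _ h₂)
  generalize hB : A - diffVal (P, Q) * 2 ^ (m + 1) = B at hs
  have v₀ : A - diffVal (false :: P, false :: Q) * 2 ^ m = B := by
    rw [← hB]; simp [diffVal, binVal]; ring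
  have v₁ : A - diffVal (true :: P, false :: Q) * 2 ^ m = B - 2 ^ m := by
    rw [← hB]; simp [diffVal, binVal]; ring
  have v₂ : A - diffVal (false :: P, true :: Q) * 2 ^ m = B + 2 ^ m := by
    rw [← hB]; simp [diffVal, binVal]; ring
  have c₁₂ := cmp true false false true
  have c₀₁ := cmp false false true false
  have c₀₂ := cmp false false false true
  rw [v₁, v₂] at c₁₂
  rw [v₀, v₁] at c₀₁
  rw [v₀, v₂] at c₀₂
  rw [pow_succ, mul_comm] at hs
  -- If digit `-1` wins the first comparison, the two numerical lemmas are applied to `-B`.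
  have hs' : |-B| < 2 * 2 ^ m := by rwa [abs_neg]
  have n₁ : (-B - 2 ^ m) ^ 2 = (B + 2 ^ m) ^ 2 := by ring
  have n₂ : (-B + 2 ^ m) ^ 2 = (B - 2 ^ m) ^ 2 := by ring
  unfold digitStep
  cases hx : fracLe (ask (true :: P, false :: Q)) (ask (false :: P, true :: Q)) <;>
    dsimp only [cond_true, cond_false]
  · have hd := c₁₂.2 hx
    cases hy : fracLe (ask (false :: P, false :: Q)) (ask (false :: P, true :: Q)) <;>
      dsimp only [cond_true, cond_false]
    · have := abs_sub_lt_of_sq_le hs' (by rwa [n₁, n₂]) (by rw [n₁, neg_sq]; exact c₀₂.2 hy)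
      rw [v₂]
      rwa [← abs_neg, show -(B + 2 ^ m) = -B - 2 ^ m by ring]
    · rw [v₀, ← abs_neg]
      exact abs_lt_of_sq_le hs' (by rwa [n₁, n₂]) (by rw [n₁, neg_sq]; exact c₀₂.1 hy)
  · have hd := c₁₂.1 hx
    cases hy : fracLe (ask (false :: P, false :: Q)) (ask (true :: P, false :: Q)) <;>
      dsimp only [cond_true, cond_false]
    · rw [v₁]
      exact abs_sub_lt_of_sq_le hs hd (c₀₁.2 hy)
    · rw [v₀]
      exact abs_lt_of_sq_le hs hd (c₀₁.1 hy)

/-- Find `N` signed digits. -/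
def search (ask : List Bool × List Bool → List Bool) (N : ℕ) : List Bool × List Bool :=
  (unary N).foldl (fun s _ => digitStep ask s) ([], [])

theorem Compares.diffVal_search {A : ℤ} {N : ℕ} {ask : List Bool × List Bool → List Bool}
    (h : Compares A N ask) (hA : |A| < 2 ^ N) : diffVal (search ask N) = A := by
  have key : ∀ (m : ℕ) (s : List Bool × List Bool), s.1.length + m = N → s.2.length + m = N →
      |A - diffVal s * 2 ^ m| < 2 ^ m →
      diffVal ((unary m).foldl (fun s _ => digitStep ask s) s) = A := by
    intro m
    induction m with
    | zero =>
      intro s _ _ hs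
      simp only [pow_zero, mul_one, Int.abs_lt_one_iff] at hs
      show diffVal s = A
      linarith
    | succ m ih =>
      intro s h₁ h₂ hs
      obtain ⟨b, c, e⟩ := digitStep_eq_or ask s
      refine ih (digitStep ask s) ?_ ?_ (h.abs_digitStep_lt h₁ h₂ hs)
      · simp [e]; omega
      · simp [e]; omega
  exact key N ([], []) (by simp) (by simp) (by simpa [diffVal, binVal] using hA)

namespace PolyTime

variable {α γ : Type} [Enc α] [Enc γ] {𝓖 : ℕ[X] → Set (List Bool → List Bool)}

theorem search {ask : (List Bool → List Bool) → γ → List Bool × List Bool → List Bool}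
    (hask : PolyTime 𝓖 fun O (p : γ × List Bool × List Bool) => ask O p.1 p.2)
    {c : (List Bool → List Bool) → α → γ} (hc : PolyTime 𝓖 c)
    {N : (List Bool → List Bool) → α → ℕ} (hN : PolyTime 𝓖 fun O a => unary (N O a)) :
    PolyTime 𝓖 fun O a => search (ask O (c O a)) (N O a) := by
  refine foldl (f := fun O c s (_ : Bool) => digitStep (ask O c) s) (fun _ => ?_) ?_ hc
    (prodMk nil nil) hN
  · have cand := fun b c : Bool => prodMk (𝓖 := 𝓖)
      (consBit b (fst (snd (.id (α := γ × List Bool × List Bool)))))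
      (consBit c (snd (snd (.id (α := γ × List Bool × List Bool)))))
    have ask' := fun {s : (List Bool → List Bool) → γ × List Bool × List Bool →
        List Bool × List Bool} (hs : PolyTime 𝓖 s) => hask.comp (prodMk (fst .id) hs)
    have hm := cond (fracLe (ask' (cand true false)) (ask' (cand false true)))
      (cand true false) (cand false true)
    exact cond (fracLe (ask' (cand false false)) (ask' hm)) (cand false false) hm
  -- One more bit costs two in the first component of a pair and one in the second.
  · refine fun q => ⟨C 3, fun O _ c s _ => ?_⟩
    obtain ⟨b, b', e⟩ := digitStep_eq_or (ask O c) s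
    simp [e, length_pair]
    omega

end PolyTime

/-! ### Hardness -/

-- By determinism, a halting run within the time bound is the only run, so the existential statement
-- in `boolFn` just reads off its output.
open Classical in
theorem boolFn_eq {P : Prog} {x : List Bool} {n t : ℕ} {W : List Bool → Bool}
    (h : ∀ y : List Bool, y.length = n → Runs noOracle P (input₂ x y) t (input [W y])) :
    boolFn P x n t = fun y => W (List.ofFn y) := by
  funext y
  obtain ⟨t', ht', e⟩ := h (List.ofFn y) (by simp)
  rw [boolFn]
  cases hW : W (List.ofFn y)
  · rw [decide_eq_false_iff_not]
    rintro ⟨t₁, s, -, e', hs⟩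
    rw [← (e.det e').2, hW] at hs
    simp [input] at hs
  · rw [decide_eq_true_iff]
    exact ⟨t', _, ht', e, by simp [input, hW]⟩

/-- The oracles whose answers have length bounded by a polynomial. -/
def lengthBounded (q : ℕ[X]) : Set (List Bool → List Bool) :=
  {O | ∀ z, (O z).length ≤ q.eval z.length}

theorem CookReducible.of_polyTime {g : List Bool → ℤ} {R : List Bool → List Bool → Prop}
    {F : (List Bool → List Bool) → List Bool → List Bool} (hF : PolyTime lengthBounded F)
    (h : ∀ O, (∀ z, R z (O z)) → ∀ x, F O x = encodeInt (g x)) : CookReducible g R := by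
  obtain ⟨M, hM⟩ := hF
  refine ⟨M, fun q => ?_⟩
  obtain ⟨T, hT⟩ := hM q
  refine ⟨T, fun O hR hO x => ?_⟩
  obtain ⟨t, ht, e⟩ := hT O hO x
  exact ⟨t, _, ht, e, h O hR x⟩

theorem compares_of_approx {approx : ℕ → ℝ → ℝ → Prop} (happrox : Discriminates approx)
    {O : List Bool → List Bool} (hO : ∀ z, ApproxNgapSq approx z (O z)) {P : Prog} {A : ℤ} {N n : ℕ}
    {w : List Bool × List Bool → List Bool} {t : List Bool × List Bool → ℕ}
    (hgap : ∀ (m : ℕ) (s : List Bool × List Bool), s.1.length + m = N → s.2.length + m = N →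
      gap (boolFn P (w s) n (t s)) = 2 * (A - diffVal s * 2 ^ m)) :
    Compares A N fun s => O (encodeInstance P (w s) n (t s)) := by
  intro m s s' h₁ h₂ h₁' h₂'
  obtain ⟨a, d, hd, e, happ⟩ := hO _ P (w s) n (t s) rfl
  obtain ⟨a', d', hd', e', happ'⟩ := hO _ P (w s') n (t s') rfl
  rw [ngap, hgap m s h₁ h₂] at happ
  rw [ngap, hgap m s' h₁' h₂'] at happ'
  have hmax : ∀ (a : ℤ) (d : ℕ), 0 < d → max ((a : ℝ) / d) 0 = ((max a 0 : ℤ) : ℝ) / d := by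
    intro a d hd
    rw [Int.cast_max, Int.cast_zero, ← max_div_div_right (by positivity), zero_div]
  have hdR : (0 : ℝ) < d := by exact_mod_cast hd
  have hdR' : (0 : ℝ) < d' := by exact_mod_cast hd'
  have hle : fracLe (O (encodeInstance P (w s) n (t s))) (O (encodeInstance P (w s') n (t s')))
      = true ↔ max ((a : ℝ) / d) 0 ≤ max ((a' : ℝ) / d') 0 := by
    rw [e, e', fracLe_encodeFrac, hmax a d hd, hmax a' d' hd', div_le_div_iff₀ hdR hdR']
    exact_mod_cast Iff.rfl
  refine ⟨fun h => happrox n _ _ _ _ happ happ' (hle.1 h), fun h => ?_⟩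
  refine happrox n _ _ _ _ happ' happ (le_of_not_ge fun h' => ?_)
  rw [hle.2 h'] at h
  exact Bool.noConfusion h

theorem PolyTimePred.padded {V : List Bool → List Bool → Bool} (h : PolyTimePred V) (p : ℕ[X])
    {α : Type} [Enc α] {x y : (List Bool → List Bool) → α → List Bool} (hx : PolyTime plain x)
    (hy : PolyTime plain y) :
    PolyTime plain fun O a => padded (unary (p.eval (x O a).length)) (V (x O a)) (y O a) := by
  have hs := (hx.unary_length.unary_eval p).splitRev hy
  exact PolyTime.bit₂ (fun a b => a && b) (h.polyTime.comp (hx.prodMk hs.snd.reverse))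
    hs.fst.allFalse

theorem gapPHard_of_discriminates {approx : ℕ → ℝ → ℝ → Prop} (happrox : Discriminates approx) :
    GapPHard (ApproxNgapSq approx) := by
  rintro g ⟨a, b, ⟨V, p, hV, ha⟩, ⟨V', p', hV', hb⟩, hg⟩
  have hW : PolyTime plain fun _ (z : (List Bool × List Bool × List Bool) × List Bool) =>
      instFn (padded (unary (p.eval z.1.1.length)) (V z.1.1))
        (padded (unary (p'.eval z.1.1.length)) (V' z.1.1)) z.1.2.1.reverse z.1.2.2.reverse z.2 := by
    have hz := PolyTime.id (𝓖 := plain) (α := (List Bool × List Bool × List Bool) × List Bool)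
    have hy := hz.snd.tail.tail
    have hs := hz.snd.headD
    exact PolyTime.bit₂ (fun a b => a ^^ b) hs (PolyTime.cond hz.snd.tail.headD
      (hs.cond (hz.fst.snd.fst.reverse.lookup hy) (hz.fst.snd.snd.reverse.lookup hy))
      (hs.cond (hV'.padded p' hz.fst.fst hy) (hV.padded p hz.fst.fst hy)))
  obtain ⟨P, T, hT⟩ := hW.exists_prog
  -- This length accommodates both kinds of witnesses, and the `+ 1` makes `|g x| < 2 ^ N x` strict.
  let N : List Bool → ℕ := fun x => (p + p' + 1).eval x.length
  let w : List Bool → List Bool × List Bool → List Bool := fun x s => enc (x, s)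
  -- The time bound covers `P` on every input of the instance; the two extra bits are the sign and
  -- the selector.
  let t : List Bool → List Bool × List Bool → ℕ := fun x s =>
    T.eval ((w x s).length + (N x + 2))
  have hask : PolyTime lengthBounded fun O (z : List Bool × List Bool × List Bool) =>
      O (encodeInstance P (w z.1 z.2) (N z.1 + 2) (t z.1 z.2)) := by
    have hz := PolyTime.id (𝓖 := lengthBounded) (α := List Bool × List Bool × List Bool)
    have hw := hz.raw
    have hn := (hz.fst.unary_length.unary_eval (p + p' + 1)).unary_add (.const (unary 2))
    have ht := (hw.unary_length.unary_add hn).unary_eval T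
    exact PolyTime.query (fun q => ⟨q, fun O hO => hO⟩)
      (((PolyTime.const (encodeProg P)).prodMk (hw.prodMk (hn.prodMk ht))).raw)
  have hsearch := PolyTime.search (ask := fun O x s =>
    O (encodeInstance P (w x s) (N x + 2) (t x s))) hask .id
    (PolyTime.id.unary_length.unary_eval (p + p' + 1))
  refine .of_polyTime (hsearch.fst.signedSub hsearch.snd) fun O hO x => ?_
  rw [signedSub_eq]
  congr 1
  have hN : N x = p.eval x.length + p'.eval x.length + 1 := by simp [N]
  have hax := (ha x).trans (card_eq_count (V x) _)
  have hbx := (hb x).trans (card_eq_count (V' x) _)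
  have hcount : ∀ V : List Bool → Bool,
      count (padded (unary (p.eval x.length)) V) (N x) = count V (p.eval x.length) := by
    intro V
    simpa [hN, add_assoc] using count_padded (unary (p.eval x.length)) V (p'.eval x.length + 1)
  have hcount' : ∀ V : List Bool → Bool,
      count (padded (unary (p'.eval x.length)) V) (N x) = count V (p'.eval x.length) := by
    intro V
    have := count_padded (unary (p'.eval x.length)) V (p.eval x.length + 1)
    rw [PolyTime.length_unary] at this
    rw [← this, hN]
    congr 1
    ring
  refine (compares_of_approx happrox hO fun m s h₁ h₂ => ?_).diffVal_search (N := N x) ?_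
  · rw [boolFn_eq fun y hy => by have h := hT (x, s) y; rw [hy] at h; exact h]
    dsimp only
    -- Splitting `N x` as digits plus `m` free bits makes `count_lookup` produce the factor `2 ^ m`;
    -- this is done separately for the positive and the negative digits.
    rw [gap_instFn, hcount, hcount', ← hax, ← hbx, hg, ← h₁, count_lookup, h₁,
      ← h₂, count_lookup, diffVal]
    push_cast
    ring
  · have ha' : a x ≤ 2 ^ p.eval x.length := hax ▸ count_le _ _
    have hb' : b x ≤ 2 ^ p'.eval x.length := hbx ▸ count_le _ _
    have h₁ : 2 ^ p.eval x.length < 2 ^ N x := Nat.pow_lt_pow_right (by simp) (by omega)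
    have h₂ : 2 ^ p'.eval x.length < 2 ^ N x := Nat.pow_lt_pow_right (by simp) (by omega)
    zify at ha' hb' h₁ h₂
    rw [hg, abs_lt]
    constructor <;> linarith [(a x).cast_nonneg (α := ℤ), (b x).cast_nonneg (α := ℤ)]

end NGap

theorem mainTheorem3 :
    (∀ ε : ℝ, 0 < ε → ε < 1 / 2 →
      NGap.GapPHard (NGap.ApproxNgapSq fun _ => NGap.RelApprox ε)) ∧
    NGap.GapPHard (NGap.ApproxNgapSq fun n => NGap.AddApprox (1 / 2 ^ (2 * n))) :=
  ⟨fun _ h₀ h₁ => NGap.gapPHard_of_discriminates (NGap.discriminates_relApprox h₀ h₁),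
    NGap.gapPHard_of_discriminates NGap.discriminates_addApprox⟩
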